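/- **Setting.** All norms on $\mathbb{R}^d$ are Euclidean unless indicated. Let $A:\mathbb{R}^d\to\mathbb{R}^d$ be monotone ($\langle A(x)-A(y),x-y\rangle\ge 0$ for all $x,y$) and $L$-Lipschitz, $L>0$, and suppose that the variational inequality "find $x^\star$ with $\langle A(x^\star),x-x^\star\rangle\ge 0$ for all $x\in\mathbb{R}^d$" has a solution. Let $\mathcal{X}\subset\mathbb{R}^d$ be a compact neighbourhood of a solution, let $\mathrm{Gap}_{\mathcal{X}}(\hat x)=\sup_{p\in\mathcal{X}}\langle A(p),\hat x-p\rangle$, let $X_1\in\mathbb{R}^d$, and let $D\ge 0$ be given by $D^2=\sup_{p\in\mathcal{X}}\|X_1-p\|^2$. **Oracles.** There are $K\ge 1$ nodes. Node $k$ has a jointly measurable stochastic oracle $g_k(x;\omega)$, $\omega\sim\mathbb{P}$, with *absolute noise*, i.e. for every $x$, $\mathbb{E}[g_k(x;\omega)]=A(x)$ and $\mathbb{E}\|g_k(x;\omega)-A(x)\|^2\le\sigma^2$ ($\sigma\ge 0$), and *almost surely bounded*: $\|g_k(x;\omega)\|\le J$ almost surely, for every $x$ ($J>0$). **Layer-wise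 quantization.** Each coordinate $i\in[d]$ has a type $m(i)\in[M]$. A sequence of levels of type $m$ is $0=\ell_0<\ell_1<\dots<\ell_{\alpha_m}<\ell_{\alpha_m+1}=1$. For an integer $q\ge 1$ and sequences $\ell^1,\dots,\ell^M$, the quantization $Q(v)$ of $v\in\mathbb{R}^d$ has coordinates $\|v\|_q\,\mathrm{sign}(v_i)\,q_{\ell^{m(i)}}(|v_i|/\|v\|_q)$, where the $q_\ell(u)$ are drawn independently and, if $\ell_\tau\le u<\ell_{\tau+1}$, $q_\ell(u)=\ell_{\tau+1}$ with probability $(u-\ell_\tau)/(\ell_{\tau+1}-\ell_\tau)$ and $q_\ell(u)=\ell_\tau$ otherwise ($q_\ell(1)=1$; $Q(0)=0$). The variance bound of a sequence $\ell=(\ell_0,\dots,\ell_{\alpha+1})$ is $$\varepsilon_Q(\ell)=\frac{(\bar\ell-1)^2}{4\bar\ell}+\bigl(\ell_1d^{1/\min\{q,2\}}-1\bigr)\mathbf{1}\{d\ge d_{th}\}+\frac{\ell_1^2}{4}d^{2/\min\{q,2\}}\mathbf{1}\{d<d_{th}\},$$ with $\bar\ell=\max_{1\le j\le\alpha}\ell_{j+1}/\ell_j$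 ($\bar\ell=1$ if $\alpha=0$) and $d_{th}=(2/\ell_1)^{\min\{2,q\}}$. **Algorithm (QODA with the alternative learning rates).** Put $Y_1=0$ and $\hat V_{k,1/2}=0$ for all $k$. For $t=1,2,\dots$ $$X_{t+1/2}=X_t-\frac{\gamma_t}{K}\sum_{k=1}^K\hat V_{k,t-1/2},\qquad \hat V_{k,t+1/2}=Q_t\bigl(g_k(X_{t+1/2};\omega_{k,t})\bigr),$$ $$Y_{t+1}=Y_t-\frac1K\sum_{k=1}^K\hat V_{k,t+1/2},\qquad X_{t+1}=X_1+\eta_{t+1}Y_{t+1},$$ where, for a fixed $\hat q\in(0,1/4]$ (empty sums being $0$), $$\gamma_t=\Bigl(1+\sum_{s=1}^{t-2}\sum_{k=1}^K\frac{\|\hat V_{k,s+1/2}\|^2}{K^2}\Bigr)^{\hat q-\frac12},\qquad \eta_t=\Bigl(1+\sum_{s=1}^{t-2}\Bigl(\sum_{k=1}^K\frac{\|\hat V_{k,s+1/2}\|^2}{K^2}+\|X_s-X_{s+1}\|^2\Bigr)\Bigr)^{-\frac12}.$$ The samples $\omega_{k,t}\sim\mathbb{P}$ and the rounding variables of the quantizers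 of iteration $t$ are independent over the nodes and coordinates, independent of each other and of everything before iteration $t$. The quantizer $Q_t$ uses, for each type $m$, the sequence of levels of type $m$ in force at iteration $t$; it may depend on the past (adaptive levels). The successive sequences of type $m$ are $\ell^m_1,\dots,\ell^m_{J^m}$, and which of them is in force at which iteration is fixed in advance. **Average variance.** For a horizon $T\ge 1$ let $\varepsilon_{Q,m,j}$ be numbers with $\varepsilon_Q(\ell^m_j)\le\varepsilon_{Q,m,j}$ almost surely, and let $T_{m,j}$ be the numbers of iterations credited to $\ell^m_j$: $0\le T_{m,j}\le\#\{t\in[T]:\ell^m_j\text{ is in force at }t\}$ and $\sum_{m=1}^M\sum_{j=1}^{J^m}T_{m,j}=T$. Put $$\widehat{\varepsilon_Q}=\frac1T\sum_{m=1}^M\sum_{j=1}^{J^m}T_{m,j}\sqrt{\varepsilon_{Q,m,j}},\qquad \bar X_{t+1/2}=\frac1T\sum_{t=1}^TX_{t+1/2}.$$ **Theorem.** For all $d$, $K\ge 1$, $L,J>0$, every $N\in\mathbb{N}$ and every $D_0>0$ there is a constant $C$, depending on these data only, such that in every situation as above with $D\ge D_0$ and $\alpha_1,\dots,\alpha_M\le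 N$, and for every $T\ge 1$, $\mathrm{Gap}_{\mathcal{X}}(\bar X_{t+1/2})$ is integrable and $$\mathbb{E}\bigl[\mathrm{Gap}_{\mathcal{X}}(\bar X_{t+1/2})\bigr]\le C\,\frac{\bigl((LD+\|A(X_1)\|+\sigma)\,\widehat{\varepsilon_Q}+\sigma\bigr)D^4}{\sqrt T}.$$ -/

import Mathlib

open MeasureTheory ProbabilityTheory Topology

universe u v

noncomputable section

/-- The space `ℝ^d` with its Euclidean norm. -/
abbrev Vec (d : ℕ) : Type := EuclideanSpace ℝ (Fin d)

/-! ### Variational inequalities -/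

/-- `x` solves the variational inequality: `⟨A x, y - x⟩ ≥ 0` for all `y`. -/
def IsVISolution {d : ℕ} (A : Vec d → Vec d) (x : Vec d) : Prop :=
  ∀ y, 0 ≤ inner ℝ (A x) (y - x)

/-- Monotonicity of an operator. -/
def IsMonotoneOperator {d : ℕ} (A : Vec d → Vec d) : Prop :=
  ∀ x y, 0 ≤ inner ℝ (A x - A y) (x - y)

/-- `L`-Lipschitzness of an operator. -/
def IsLipschitzOperator {d : ℕ} (L : ℝ) (A : Vec d → Vec d) : Prop :=
  ∀ x y, ‖A x - A y‖ ≤ L * ‖x - y‖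

/-- The restricted gap function `sup_{p ∈ 𝒳} ⟨A p, x - p⟩`. -/
def gap {d : ℕ} (A : Vec d → Vec d) (𝒳 : Set (Vec d)) (x : Vec d) : ℝ :=
  ⨆ p : 𝒳, inner ℝ (A p) (x - p)

/-! ### Stochastic oracles -/

/-- Absolute noise: the oracle `g` is unbiased for `A`, and its error has second moment at most
`σ ^ 2` at every point. -/
def AbsoluteNoise {d : ℕ} {Ξ : Type*} [MeasurableSpace Ξ] (P : Measure Ξ)
    (A : Vec d → Vec d) (g : Vec d → Ξ → Vec d) (σ : ℝ) : Prop :=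
  ∀ x, Integrable (g x) P ∧ ∫ ξ, g x ξ ∂P = A x ∧
    Integrable (fun ξ => ‖g x ξ - A x‖ ^ 2) P ∧ ∫ ξ, ‖g x ξ - A x‖ ^ 2 ∂P ≤ σ ^ 2

/-- Almost sure boundedness of the oracle by `J`. -/
def AlmostSurelyBounded {d : ℕ} {Ξ : Type*} [MeasurableSpace Ξ] (P : Measure Ξ)
    (g : Vec d → Ξ → Vec d) (J : ℝ) : Prop :=
  ∀ x, ∀ᵐ ξ ∂P, ‖g x ξ‖ ≤ J

/-! ### Layer-wise quantization -/

/-- A sequence of quantization levels `0 = ℓ_0 < ℓ_1 < ⋯ < ℓ_α < ℓ_{α+1} = 1`. -/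
structure IsLevelSeq {α : ℕ} (l : Fin (α + 2) → ℝ) : Prop where
  strictMono : StrictMono l
  zero : l 0 = 0
  last : l (Fin.last (α + 1)) = 1

/-- The index `τ(u)` with `ℓ_{τ(u)} ≤ u < ℓ_{τ(u)+1}` (and `τ(1) = α`): the largest
`j ∈ {0, …, α}` with `ℓ_j ≤ u`. -/
def levelIndex {α : ℕ} (l : Fin (α + 2) → ℝ) (u : ℝ) : Fin (α + 1) :=
  (Finset.univ.filter fun j : Fin (α + 1) => l j.castSucc ≤ u).sup id

/-- The relative distance `ξ(u) = (u - ℓ_τ) / (ℓ_{τ+1} - ℓ_τ)`, where `τ = τ(u)`. -/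
def relDist {α : ℕ} (l : Fin (α + 2) → ℝ) (u : ℝ) : ℝ :=
  (u - l (levelIndex l u).castSucc) / (l (levelIndex l u).succ - l (levelIndex l u).castSucc)

/-- Randomized rounding of `u ∈ [0,1]`, driven by a variable `w` uniform on `[0,1]`: the value is
`ℓ_{τ(u)+1}` with probability `ξ(u)` and `ℓ_{τ(u)}` with probability `1 - ξ(u)`. -/
def quantCoord {α : ℕ} (l : Fin (α + 2) → ℝ) (u w : ℝ) : ℝ :=
  if w < relDist l u then l (levelIndex l u).succ else l (levelIndex l u).castSucc

/-- The `L^q` norm of a vector. -/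
def lqNorm {d : ℕ} (q : ℕ) (v : Vec d) : ℝ :=
  (∑ i, |v i| ^ q) ^ ((1 : ℝ) / q)

/-- Layer-wise quantization: coordinate `i`, of type `typ i`, becomes
`‖v‖_q * sign (v_i) * q_ℓ (|v_i| / ‖v‖_q)` with the levels `ℓ` of its type. -/
def quantize {d M : ℕ} {α : Fin M → ℕ} (q : ℕ) (typ : Fin d → Fin M)
    (l : (m : Fin M) → Fin (α m + 2) → ℝ) (v : Vec d) (w : Fin d → ℝ) : Vec d :=
  WithLp.toLp 2 fun i =>
    lqNorm q v * Real.sign (v i) * quantCoord (l (typ i)) (|v i| / lqNorm q v) (w i)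

/-- The largest ratio `ℓ_{j+1} / ℓ_j`, `1 ≤ j ≤ α`, of consecutive positive levels (it is `1` if
`α = 0`, when there is no such ratio). -/
def levelRatio {α : ℕ} (l : Fin (α + 2) → ℝ) : ℝ :=
  Finset.univ.sup' Finset.univ_nonempty fun j : Fin (α + 1) =>
    if j = 0 then 1 else l j.succ / l j.castSucc

/-- The variance bound `ε_Q` of a sequence of levels in dimension `d` with `L^q` normalization. -/
def varianceBound (d q : ℕ) {α : ℕ} (l : Fin (α + 2) → ℝ) : ℝ :=
  (levelRatio l - 1) ^ 2 / (4 * levelRatio l)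
    + (if (2 / l 1) ^ min 2 q ≤ (d : ℝ)
        then l 1 * (d : ℝ) ^ ((1 : ℝ) / (min q 2 : ℕ)) - 1
        else l 1 ^ 2 / 4 * (d : ℝ) ^ ((2 : ℝ) / (min q 2 : ℕ)))

/-! ### Quantized optimistic dual averaging -/

/-- The sum over `s = 1, …, n` of `∑_k ‖V̂_{k,s+1/2}‖² / K²`; here `Vh s k` is `V̂_{k,s+1/2}`. -/
def sumSqDual {d K : ℕ} (Vh : ℕ → Fin K → Vec d) (n : ℕ) : ℝ :=
  ∑ s ∈ Finset.Icc 1 n, ∑ k, ‖Vh s k‖ ^ 2 / (K : ℝ) ^ 2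

/-- The sum over `s = 1, …, n` of `‖X_s - X_{s+1}‖²`. -/
def sumSqMove {d : ℕ} (X : ℕ → Vec d) (n : ℕ) : ℝ :=
  ∑ s ∈ Finset.Icc 1 n, ‖X s - X (s + 1)‖ ^ 2

/-- The alternative learning rate `γ_t` with exponent parameter `qhat`
(the sum is empty for `t ≤ 2`). -/
def gammaAlt {d K : ℕ} (qhat : ℝ) (Vh : ℕ → Fin K → Vec d) (t : ℕ) : ℝ :=
  (1 + sumSqDual Vh (t - 2)) ^ (qhat - 1 / 2)

/-- The alternative learning rate `η_t` (the sums are empty for `t ≤ 2`). -/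
def etaAlt {d K : ℕ} (X : ℕ → Vec d) (Vh : ℕ → Fin K → Vec d) (t : ℕ) : ℝ :=
  (1 + (sumSqDual Vh (t - 2) + sumSqMove X (t - 2))) ^ (-(1 / 2) : ℝ)

/-- The average over the `K` nodes. -/
def nodeAvg {d K : ℕ} (v : Fin K → Vec d) : Vec d := (K : ℝ)⁻¹ • ∑ k, v k

/-- `(X_t)`, `(X_{t+1/2})`, `(Y_t)`, `(V̂_{k,t+1/2})` are the iterates of QODA with the alternative
learning rates, started at `x₁`. Here `Xh t` is `X_{t+1/2}` and `Vh t k` is `V̂_{k,t+1/2}`;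
`lev t m` is the sequence of levels of type `m` in force at iteration `t`, and `ζ t k` is the
randomness that node `k` uses at iteration `t`: its oracle sample and the rounding variables of
its quantizer. -/
structure IsQODARun {d K M : ℕ} {Ξ : Type*} {α : Fin M → ℕ} (q : ℕ) (typ : Fin d → Fin M)
    (qhat : ℝ) (g : Fin K → Vec d → Ξ → Vec d) (x₁ : Vec d)
    (lev : ℕ → (m : Fin M) → Fin (α m + 2) → ℝ) (ζ : ℕ → Fin K → Ξ × (Fin d → ℝ))
    (X Xh Y : ℕ → Vec d) (Vh : ℕ → Fin K → Vec d) : Prop where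
  init_X : X 1 = x₁
  init_Y : Y 1 = 0
  init_Vh : ∀ k, Vh 0 k = 0
  extrapolate : ∀ t, 1 ≤ t → Xh t = X t - gammaAlt qhat Vh t • nodeAvg (Vh (t - 1))
  query : ∀ t, 1 ≤ t → ∀ k, Vh t k = quantize q typ (lev t) (g k (Xh t) (ζ t k).1) (ζ t k).2
  dual : ∀ t, 1 ≤ t → Y (t + 1) = Y t - nodeAvg (Vh t)
  update : ∀ t, 1 ≤ t → X (t + 1) = x₁ + etaAlt X Vh (t + 1) • Y (t + 1)

/-- The joint law of the randomness of one iteration: over the `K` nodes, independent oracle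
samples of law `P` and independent families of `d` independent uniform variables on `[0,1]`. -/
def sampleLaw (d K : ℕ) {Ξ : Type*} [MeasurableSpace Ξ] (P : Measure Ξ) :
    Measure (Fin K → Ξ × (Fin d → ℝ)) :=
  Measure.pi fun _ => P.prod (Measure.pi fun _ => volume.restrict (Set.Icc (0 : ℝ) 1))

/-- Fresh sampling along a filtration `ℱ`, where `ℱ t` is the information available after
iteration `t`: the randomness `ζ (t + 1)` of iteration `t + 1` is known after that iteration, has
law `sampleLaw`, and is independent of `ℱ t`. -/
structure IsFreshSampling {d K : ℕ} {Ξ Ω : Type*} [MeasurableSpace Ξ] [mΩ : MeasurableSpace Ω]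
    (μ : Measure Ω) (P : Measure Ξ) (ℱ : Filtration ℕ mΩ)
    (ζ : ℕ → Ω → Fin K → Ξ × (Fin d → ℝ)) : Prop where
  adapted : ∀ t, Measurable[ℱ (t + 1)] (ζ (t + 1))
  law : ∀ t, μ.map (ζ (t + 1)) = sampleLaw d K P
  indep : ∀ t, Indep (MeasurableSpace.comap (ζ (t + 1)) inferInstance) (ℱ t) μ

/-- The average square root variance bound `∑_m ∑_j T_{m,j} √ε_{Q,m,j} / T`. -/
def avgSqrtVariance {M : ℕ} {J : Fin M → ℕ} (T : ℕ) (Tmj ε : (m : Fin M) → Fin (J m) → ℝ) : ℝ :=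
  (∑ m, ∑ j, Tmj m j * √(ε m j)) / T

end

/-! The factor multiplying `C` is itself bounded below by a multiple of `D ^ 5 / √T`, so it suffices
to bound the expected gap by a constant times `(D ^ 2 + 1) / √T`, the constant depending on `d`,
`K`, `L`, `J` only. Indeed, with at most `N` inner levels no sequence has a small variance bound
(`IsLevelSeq.le_varianceBound`), hence the average of the square roots is at least some `c₀ > 0`
(`le_avgSqrtVariance`). The summand `L * D` then supplies `L * c₀ * D * D ^ 4`, and `D₀ ≤ D` absorbs
`D ^ 2 + 1` into `D ^ 5`.

For the upper bound, rounding never exceeds the `L^q` norm, so every exchanged vector is almost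
surely bounded by `G = d ^ 2 * J`. By monotonicity the gap of the average is at most the largest
regret over the test points `p`, divided by `T` (`gap_average_le`). The regret bound for optimistic
dual averaging (`optimistic_regret_le`) has three parts.

The stability part is a self-normalized sum of squared feedback, of order `√T` because the feedback
is bounded. The part `‖p - x₁‖ ^ 2 / (2 * η)` needs `1 / η` of order `√T`. This is the delicate
point, since `η` is built from the squared moves of the iterates, which in turn depend on `η`;
`sum_sq_move_le` breaks the circle by splitting time where the energy first exceeds the horizon.

The last part is noise. Recentring at `x₁` makes almost all of it products of an error with a vector
known before that error is drawn, so the mean vanishes (`integral_inner_feedbackNoise`). What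
remains is the accumulated error against `p - x₁`, with a supremum over `p`: Cauchy–Schwarz gives
`D` times the norm of the accumulated error, whose second moment is at most `T * (G + J) ^ 2`
because the errors are orthogonal. -/

noncomputable section

/-! ### Levels and randomized rounding -/

namespace IsLevelSeq

variable {α : ℕ} {l : Fin (α + 2) → ℝ}

theorem nonneg (hl : IsLevelSeq l) (j : Fin (α + 2)) : 0 ≤ l j :=
  hl.zero ▸ hl.strictMono.monotone (Fin.zero_le j)

theorem le_one (hl : IsLevelSeq l) (j : Fin (α + 2)) : l j ≤ 1 :=
  hl.last ▸ hl.strictMono.monotone (Fin.le_last j)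

theorem levelIndex_le (hl : IsLevelSeq l) {u : ℝ} (hu : 0 ≤ u) :
    l (levelIndex l u).castSucc ≤ u := by
  have hne : (Finset.univ.filter fun j : Fin (α + 1) => l j.castSucc ≤ u).Nonempty :=
    ⟨0, by simpa [hl.zero] using hu⟩
  obtain ⟨j, hj, hje⟩ := Finset.exists_mem_eq_sup _ hne id
  have : levelIndex l u = j := hje
  rw [this]
  exact (Finset.mem_filter.1 hj).2

/-- By maximality: were `u` beyond the next level, the next index would compete in the supremum that
defines `levelIndex`. At the top the next level is 1. -/
theorem le_levelIndex_succ (hl : IsLevelSeq l) {u : ℝ} (hu : u ≤ 1) :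
    u ≤ l (levelIndex l u).succ := by
  by_contra! h
  rcases Fin.eq_castSucc_or_eq_last (levelIndex l u).succ with ⟨j, hj⟩ | hj
  · have hmem : j ∈ Finset.univ.filter fun j : Fin (α + 1) => l j.castSucc ≤ u := by
      simp only [Finset.mem_filter, Finset.mem_univ, true_and]
      rw [← hj]; exact h.le
    have hle : j ≤ levelIndex l u := Finset.le_sup (f := id) hmem
    have h1 := congrArg Fin.val hj
    rw [Fin.val_succ, Fin.val_castSucc] at h1
    have h2 : (j : ℕ) ≤ (levelIndex l u : ℕ) := hle
    omega
  · rw [hj, hl.last] at h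
    linarith

theorem levelIndex_lt (hl : IsLevelSeq l) (u : ℝ) :
    l (levelIndex l u).castSucc < l (levelIndex l u).succ :=
  hl.strictMono Fin.castSucc_lt_succ

theorem relDist_nonneg (hl : IsLevelSeq l) {u : ℝ} (hu : 0 ≤ u) : 0 ≤ relDist l u :=
  div_nonneg (sub_nonneg.2 (hl.levelIndex_le hu)) (sub_nonneg.2 (hl.levelIndex_lt u).le)

theorem relDist_le_one (hl : IsLevelSeq l) {u : ℝ} (hu : u ≤ 1) : relDist l u ≤ 1 :=
  div_le_one_of_le₀ (sub_le_sub_right (hl.le_levelIndex_succ hu) _)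
    (sub_nonneg.2 (hl.levelIndex_lt u).le)

theorem quantCoord_nonneg (hl : IsLevelSeq l) (u w : ℝ) : 0 ≤ quantCoord l u w := by
  unfold quantCoord; split_ifs <;> exact hl.nonneg _

theorem quantCoord_le_one (hl : IsLevelSeq l) (u w : ℝ) : quantCoord l u w ≤ 1 := by
  unfold quantCoord; split_ifs <;> exact hl.le_one _

/-- Randomized rounding is unbiased. -/
theorem integral_quantCoord (hl : IsLevelSeq l) {u : ℝ} (h0 : 0 ≤ u) (h1 : u ≤ 1) :
    ∫ w in Set.Icc (0 : ℝ) 1, quantCoord l u w = u := by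
  -- Rounding is the lower level plus the spacing times an indicator of probability `relDist l u`;
  -- the mean increment is exactly the distance of `u` from the lower level.
  have hform : ∀ w, quantCoord l u w = l (levelIndex l u).castSucc +
      (Set.Iio (relDist l u)).indicator
        (fun _ => l (levelIndex l u).succ - l (levelIndex l u).castSucc) w := by
    intro w
    unfold quantCoord
    by_cases hw : w < relDist l u <;> simp [hw]
  have hvol : (volume.restrict (Set.Icc (0 : ℝ) 1)).real (Set.Iio (relDist l u)) = relDist l u := by
    rw [measureReal_restrict_apply measurableSet_Iio]
    have : Set.Iio (relDist l u) ∩ Set.Icc (0 : ℝ) 1 = Set.Ico 0 (relDist l u) := by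
      ext w
      have := hl.relDist_le_one h1
      simp only [Set.mem_inter_iff, Set.mem_Iio, Set.mem_Icc, Set.mem_Ico]
      constructor
      · rintro ⟨a, b, c⟩; exact ⟨b, a⟩
      · rintro ⟨a, b⟩; exact ⟨b, a, by linarith⟩
    rw [this, Real.volume_real_Ico_of_le (hl.relDist_nonneg h0), sub_zero]
  simp_rw [hform]
  rw [integral_add (integrable_const _) ((integrable_const _).indicator measurableSet_Iio),
    integral_indicator_const _ measurableSet_Iio, hvol]
  have hne : l (levelIndex l u).succ - l (levelIndex l u).castSucc ≠ 0 :=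
    (sub_pos.2 (hl.levelIndex_lt u)).ne'
  simp only [integral_const, smul_eq_mul, relDist, div_mul_cancel₀ _ hne]
  simp

end IsLevelSeq

/-- The levels are random as well, so joint measurability is needed. A supremum is at most `j` iff
each of its finitely many members is, which turns each sublevel set into a finite intersection. -/
theorem measurable_levelIndex {α : ℕ} :
    Measurable fun p : (Fin (α + 2) → ℝ) × ℝ => levelIndex p.1 p.2 := by
  have hle : ∀ j : Fin (α + 1),
      MeasurableSet {p : (Fin (α + 2) → ℝ) × ℝ | levelIndex p.1 p.2 ≤ j} := by
    intro j
    have : {p : (Fin (α + 2) → ℝ) × ℝ | levelIndex p.1 p.2 ≤ j} =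
        ⋂ i : Fin (α + 1), {p | p.1 i.castSucc ≤ p.2 → i ≤ j} := by
      ext p
      simp [levelIndex, Finset.sup_le_iff]
    rw [this]
    refine MeasurableSet.iInter fun i => ?_
    by_cases hij : i ≤ j
    · simp [hij]
    · simp only [hij, imp_false, not_le]
      exact measurableSet_lt measurable_snd ((measurable_pi_apply _).comp measurable_fst)
  exact measurable_of_Iic hle

theorem measurable_levels_apply {α n : ℕ} {β : Type*} [MeasurableSpace β]
    {f : β → Fin (α + 2) → ℝ} {i : β → Fin n} (e : Fin n → Fin (α + 2))
    (hf : Measurable f) (hi : Measurable i) : Measurable fun b => f b (e (i b)) := by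
  have h : Measurable fun p : (Fin (α + 2) → ℝ) × Fin n => p.1 (e p.2) :=
    measurable_from_prod_countable_left fun j => measurable_pi_apply (e j)
  exact h.comp (hf.prodMk hi)

theorem measurable_quantCoord {α : ℕ} {β : Type*} [MeasurableSpace β]
    {l : β → Fin (α + 2) → ℝ} {u w : β → ℝ} (hl : Measurable l) (hu : Measurable u)
    (hw : Measurable w) : Measurable fun b => quantCoord (l b) (u b) (w b) := by
  have hi : Measurable fun b => levelIndex (l b) (u b) :=
    measurable_levelIndex.comp (hl.prodMk hu)
  have h0 := measurable_levels_apply Fin.castSucc hl hi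
  have h1 := measurable_levels_apply Fin.succ hl hi
  refine Measurable.ite (measurableSet_lt hw ?_) h1 h0
  exact (hu.sub h0).div (h1.sub h0)

/-! ### The quantizer -/

theorem measurable_real_sign : Measurable Real.sign := by
  refine Measurable.ite measurableSet_Iio measurable_const
    (Measurable.ite measurableSet_Ioi measurable_const measurable_const)

theorem measurable_lqNorm {d : ℕ} (q : ℕ) : Measurable fun v : Vec d => lqNorm q v := by
  unfold lqNorm
  fun_prop

theorem measurable_quantize {d M : ℕ} {α : Fin M → ℕ} (q : ℕ) (typ : Fin d → Fin M)
    {β : Type*} [MeasurableSpace β] {l : β → (m : Fin M) → Fin (α m + 2) → ℝ} {v : β → Vec d}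
    {w : β → Fin d → ℝ} (hl : Measurable l) (hv : Measurable v) (hw : Measurable w) :
    Measurable fun b => quantize q typ (l b) (v b) (w b) := by
  refine (WithLp.measurable_toLp 2 _).comp (measurable_pi_lambda _ fun i => ?_)
  have hvi : Measurable fun b => v b i := by fun_prop
  have hn : Measurable fun b => lqNorm q (v b) := (measurable_lqNorm q).comp hv
  refine (hn.mul (measurable_real_sign.comp hvi)).mul (measurable_quantCoord ?_ ?_ ?_)
  · exact (measurable_pi_apply _).comp hl
  · exact (continuous_abs.measurable.comp hvi).div hn
  · exact (measurable_pi_apply _).comp hw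

theorem lqNorm_nonneg {d : ℕ} (q : ℕ) (v : Vec d) : 0 ≤ lqNorm q v :=
  Real.rpow_nonneg (Finset.sum_nonneg fun _ _ => by positivity) _

theorem abs_apply_le_lqNorm {d q : ℕ} (hq : 1 ≤ q) (v : Vec d) (i : Fin d) :
    |v i| ≤ lqNorm q v := by
  have hq0 : q ≠ 0 := by omega
  have h : |v i| ^ q ≤ ∑ i, |v i| ^ q :=
    Finset.single_le_sum (f := fun i => |v i| ^ q) (fun _ _ => by positivity) (Finset.mem_univ i)
  calc |v i| = (|v i| ^ q) ^ ((1 : ℝ) / q) := by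
        rw [one_div, Real.pow_rpow_inv_natCast (abs_nonneg _) hq0]
    _ ≤ lqNorm q v := Real.rpow_le_rpow (by positivity) h (by positivity)

theorem lqNorm_le {d q : ℕ} (hq : 1 ≤ q) (v : Vec d) : lqNorm q v ≤ d * ‖v‖ := by
  have hq0 : q ≠ 0 := by omega
  rcases Nat.eq_zero_or_pos d with rfl | hd
  · simp only [lqNorm, Finset.univ_eq_empty, Finset.sum_empty, Nat.cast_zero, zero_mul]
    rw [Real.zero_rpow (by positivity)]
  have hd1 : (1 : ℝ) ≤ d := by exact_mod_cast hd
  have hsum : ∑ i, |v i| ^ q ≤ (d * ‖v‖) ^ q := by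
    calc ∑ i, |v i| ^ q ≤ ∑ _i : Fin d, ‖v‖ ^ q := by
          refine Finset.sum_le_sum fun i _ => pow_le_pow_left₀ (abs_nonneg _) ?_ q
          exact PiLp.norm_apply_le v i
      _ = d * ‖v‖ ^ q := by simp
      _ ≤ d ^ q * ‖v‖ ^ q := by
          gcongr
          exact le_self_pow₀ hd1 hq0
      _ = (d * ‖v‖) ^ q := (mul_pow _ _ _).symm
  calc lqNorm q v ≤ ((d * ‖v‖) ^ q) ^ ((1 : ℝ) / q) :=
        Real.rpow_le_rpow (Finset.sum_nonneg fun _ _ => by positivity) hsum (by positivity)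
    _ = d * ‖v‖ := by rw [one_div, Real.pow_rpow_inv_natCast (by positivity) hq0]

theorem abs_real_sign_le_one (x : ℝ) : |Real.sign x| ≤ 1 := by
  rcases Real.sign_apply_eq x with h | h | h <;> simp [h]

theorem real_sign_mul_abs (x : ℝ) : Real.sign x * |x| = x := by
  rcases lt_trichotomy x 0 with h | h | h
  · rw [Real.sign_of_neg h, abs_of_neg h]; ring
  · simp [h]
  · rw [Real.sign_of_pos h, abs_of_pos h]; ring

theorem abs_quantize_apply_le {d M q : ℕ} {α : Fin M → ℕ} {typ : Fin d → Fin M}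
    {l : (m : Fin M) → Fin (α m + 2) → ℝ} (hl : ∀ m, IsLevelSeq (l m)) (v : Vec d)
    (w : Fin d → ℝ) (i : Fin d) : |quantize q typ l v w i| ≤ lqNorm q v := by
  change |lqNorm q v * Real.sign (v i) * quantCoord (l (typ i)) (|v i| / lqNorm q v) (w i)| ≤ _
  rw [abs_mul, abs_mul, abs_of_nonneg (lqNorm_nonneg q v)]
  have h1 := abs_real_sign_le_one (v i)
  have h2 : |quantCoord (l (typ i)) (|v i| / lqNorm q v) (w i)| ≤ 1 := by
    rw [abs_of_nonneg ((hl _).quantCoord_nonneg _ _)]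
    exact (hl _).quantCoord_le_one _ _
  have h0 := lqNorm_nonneg q v
  calc lqNorm q v * |Real.sign (v i)| * |quantCoord (l (typ i)) (|v i| / lqNorm q v) (w i)|
      ≤ lqNorm q v * 1 * 1 := by gcongr
    _ = lqNorm q v := by ring

/-- One factor `d` compares the `L^q` norm with the Euclidean norm, the other comes from summing the
coordinates. The bound is crude but uniform in `q`, the levels and the rounding variables, so no
such data enters the final constant. -/
theorem norm_quantize_le {d M q : ℕ} {α : Fin M → ℕ} {typ : Fin d → Fin M} (hq : 1 ≤ q)
    {l : (m : Fin M) → Fin (α m + 2) → ℝ} (hl : ∀ m, IsLevelSeq (l m)) (v : Vec d)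
    (w : Fin d → ℝ) : ‖quantize q typ l v w‖ ≤ d ^ 2 * ‖v‖ := by
  have h1 : ‖quantize q typ l v w‖ ≤ ∑ i, |quantize q typ l v w i| := by
    rw [EuclideanSpace.norm_eq]
    refine Real.sqrt_le_iff.2 ⟨Finset.sum_nonneg fun _ _ => abs_nonneg _, ?_⟩
    exact Finset.sum_sq_le_sq_sum_of_nonneg fun _ _ => abs_nonneg _
  calc ‖quantize q typ l v w‖ ≤ ∑ i, |quantize q typ l v w i| := h1
    _ ≤ ∑ _i : Fin d, d * ‖v‖ :=
        Finset.sum_le_sum fun i _ => (abs_quantize_apply_le hl v w i).trans (lqNorm_le hq v)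
    _ = d ^ 2 * ‖v‖ := by simp; ring

/-- The law of the rounding variables of one quantizer. -/
abbrev roundingLaw (d : ℕ) : Measure (Fin d → ℝ) :=
  Measure.pi fun _ => volume.restrict (Set.Icc (0 : ℝ) 1)

instance : IsProbabilityMeasure (volume.restrict (Set.Icc (0 : ℝ) 1)) :=
  ⟨by simp⟩

/-- The quantizer is unbiased. -/
theorem integral_quantize_apply {d M q : ℕ} {α : Fin M → ℕ} {typ : Fin d → Fin M} (hq : 1 ≤ q)
    {l : (m : Fin M) → Fin (α m + 2) → ℝ} (hl : ∀ m, IsLevelSeq (l m)) (v : Vec d) (i : Fin d) :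
    ∫ w, quantize q typ l v w i ∂roundingLaw d = v i := by
  have hle := abs_apply_le_lqNorm hq v i
  change ∫ w, lqNorm q v * Real.sign (v i) *
    quantCoord (l (typ i)) (|v i| / lqNorm q v) (w i) ∂roundingLaw d = v i
  rw [integral_const_mul]
  have hmp := measurePreserving_eval (fun _ : Fin d => volume.restrict (Set.Icc (0 : ℝ) 1)) i
  have hme : Measurable fun w => quantCoord (l (typ i)) (|v i| / lqNorm q v) w :=
    measurable_quantCoord measurable_const measurable_const measurable_id
  have heq : ∫ w, quantCoord (l (typ i)) (|v i| / lqNorm q v) (w i) ∂roundingLaw d =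
      ∫ w in Set.Icc (0 : ℝ) 1, quantCoord (l (typ i)) (|v i| / lqNorm q v) w := by
    conv_rhs => rw [← hmp.map_eq]
    rw [integral_map hmp.measurable.aemeasurable hme.aestronglyMeasurable]
  rw [heq, (hl _).integral_quantCoord (div_nonneg (abs_nonneg _) (lqNorm_nonneg q v))
    (div_le_one_of_le₀ hle (lqNorm_nonneg q v))]
  -- If the norm vanishes, the division defaults to 0, which is harmless because `v i` is then 0
  -- too.
  rcases eq_or_ne (lqNorm q v) 0 with h0 | h0
  · rw [h0] at hle
    rw [abs_nonpos_iff.1 hle, h0]; simp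
  · rw [mul_right_comm, mul_div_cancel₀ _ h0, mul_comm, real_sign_mul_abs]

/-! ### A lower bound for the variance bound -/

theorem one_le_levelRatio {α : ℕ} (l : Fin (α + 2) → ℝ) : 1 ≤ levelRatio l := by
  have h := Finset.le_sup' (s := Finset.univ)
    (fun j : Fin (α + 1) => if j = 0 then (1 : ℝ) else l j.succ / l j.castSucc)
    (Finset.mem_univ 0)
  rwa [if_pos rfl] at h

/-- Each positive level at most doubles the preceding one. At the last level, which is 1, this
forces the first positive level to be at least `2 ^ (-α)`. -/
theorem IsLevelSeq.level_le {α : ℕ} {l : Fin (α + 2) → ℝ} (hl : IsLevelSeq l)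
    (hr : levelRatio l ≤ 2) (j : ℕ) (hj : j + 1 < α + 2) : l ⟨j + 1, hj⟩ ≤ 2 ^ j * l 1 := by
  induction j with
  | zero => simp
  | succ j ih =>
    have h := Finset.le_sup' (s := Finset.univ)
      (fun j : Fin (α + 1) => if j = 0 then (1 : ℝ) else l j.succ / l j.castSucc)
      (Finset.mem_univ ⟨j + 1, by omega⟩)
    have h' : l ⟨j + 2, hj⟩ / l ⟨j + 1, by omega⟩ ≤ 2 := by
      rw [if_neg (by simp [Fin.ext_iff])] at h
      exact h.trans hr
    have hpos : 0 < l ⟨j + 1, by omega⟩ := by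
      rw [← hl.zero]; exact hl.strictMono (by simp [Fin.lt_def])
    rw [div_le_iff₀ hpos] at h'
    have := ih (by omega)
    calc l ⟨j + 1 + 1, hj⟩ ≤ 2 * l ⟨j + 1, by omega⟩ := h'
      _ ≤ 2 * (2 ^ j * l 1) := by gcongr
      _ = 2 ^ (j + 1) * l 1 := by ring

/-- Few levels cannot reach from near 0 up to 1 in small ratios. For large `d` the second term is at
least 1. Otherwise either some ratio exceeds 2 and the first term is at least 1/8, or all ratios are
at most 2, so `l 1 ≥ 2 ^ (-N)` and the last term is at least `4 ^ (-N) / 4`. -/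
theorem IsLevelSeq.le_varianceBound {d q N α : ℕ} {l : Fin (α + 2) → ℝ} (hl : IsLevelSeq l)
    (hd : 1 ≤ d) (hq : 1 ≤ q) (hα : α ≤ N) : (1 / 4 : ℝ) ^ N / 8 ≤ varianceBound d q l := by
  have hr1 := one_le_levelRatio l
  have hc1 : (1 / 4 : ℝ) ^ N ≤ 1 := pow_le_one₀ (by norm_num) (by norm_num)
  have hc0 : (0 : ℝ) < (1 / 4 : ℝ) ^ N := by positivity
  have hl1 : 0 < l 1 := by
    rw [← hl.zero]; exact hl.strictMono (by simp)
  have hd1 : (1 : ℝ) ≤ d := by exact_mod_cast hd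
  have hfirst : 0 ≤ (levelRatio l - 1) ^ 2 / (4 * levelRatio l) := by positivity
  unfold varianceBound
  split_ifs with hdt
  · have hm : min 2 q ≠ 0 := by omega
    have h1 : 2 / l 1 ≤ (d : ℝ) ^ ((1 : ℝ) / (min q 2 : ℕ)) := by
      calc 2 / l 1 = ((2 / l 1) ^ min 2 q) ^ ((1 : ℝ) / (min q 2 : ℕ)) := by
            rw [min_comm q 2, one_div, Real.pow_rpow_inv_natCast (by positivity) hm]
        _ ≤ _ := Real.rpow_le_rpow (by positivity) hdt (by positivity)
    have h2 : 2 ≤ l 1 * (d : ℝ) ^ ((1 : ℝ) / (min q 2 : ℕ)) := by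
      rw [div_le_iff₀ hl1] at h1
      linarith
    linarith
  · have h1 : 1 ≤ (d : ℝ) ^ ((2 : ℝ) / (min q 2 : ℕ)) :=
      Real.one_le_rpow hd1 (by positivity)
    have h2 : l 1 ^ 2 / 4 ≤ l 1 ^ 2 / 4 * (d : ℝ) ^ ((2 : ℝ) / (min q 2 : ℕ)) :=
      le_mul_of_one_le_right (by positivity) h1
    by_cases hr : levelRatio l ≤ 2
    · have h3 := hl.level_le hr α (by omega)
      have h4 : l ⟨α + 1, by omega⟩ = 1 := hl.last
      rw [h4] at h3
      have h5 : (1 / 2 : ℝ) ^ N ≤ l 1 := by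
        calc (1 / 2 : ℝ) ^ N ≤ (1 / 2) ^ α := pow_le_pow_of_le_one (by norm_num) (by norm_num) hα
          _ = (1 / 2) ^ α * 1 := (mul_one _).symm
          _ ≤ (1 / 2) ^ α * (2 ^ α * l 1) := by gcongr
          _ = l 1 := by rw [← mul_assoc, ← mul_pow]; norm_num
      have h6 : (1 / 4 : ℝ) ^ N ≤ l 1 ^ 2 := by
        calc (1 / 4 : ℝ) ^ N = ((1 / 2 : ℝ) ^ N) ^ 2 := by
              rw [← pow_mul, mul_comm, pow_mul]; norm_num
          _ ≤ l 1 ^ 2 := by gcongr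
      linarith
    · push Not at hr
      have h3 : 1 / 8 ≤ (levelRatio l - 1) ^ 2 / (4 * levelRatio l) := by
        rw [div_le_div_iff₀ (by norm_num) (by positivity)]
        nlinarith
      have h4 : 0 ≤ l 1 ^ 2 / 4 := by positivity
      linarith

theorem le_avgSqrtVariance {M : ℕ} {J : Fin M → ℕ} {T : ℕ} (hT : 1 ≤ T)
    {Tmj ε : (m : Fin M) → Fin (J m) → ℝ} {c : ℝ} (hc : ∀ m j, c ≤ ε m j)
    (hT0 : ∀ m j, 0 ≤ Tmj m j) (hsum : ∑ m, ∑ j, Tmj m j = T) :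
    √c ≤ avgSqrtVariance T Tmj ε := by
  have hT' : (0 : ℝ) < T := by exact_mod_cast hT
  rw [avgSqrtVariance, le_div_iff₀ hT', ← hsum, Finset.mul_sum]
  refine Finset.sum_le_sum fun m _ => ?_
  rw [Finset.mul_sum]
  refine Finset.sum_le_sum fun j _ => ?_
  rw [mul_comm]
  exact mul_le_mul_of_nonneg_left (Real.sqrt_le_sqrt (hc m j)) (hT0 m j)

end

noncomputable section

/-! ### Partial sums -/

/-- The sum `f 1 + ⋯ + f n`. -/
def partialSum (f : ℕ → ℝ) (n : ℕ) : ℝ := ∑ t ∈ Finset.Icc 1 n, f t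

@[simp] theorem partialSum_zero (f : ℕ → ℝ) : partialSum f 0 = 0 := by simp [partialSum]

theorem partialSum_succ (f : ℕ → ℝ) (n : ℕ) :
    partialSum f (n + 1) = partialSum f n + f (n + 1) :=
  Finset.sum_Icc_succ_top (by omega) f

theorem partialSum_mono {f : ℕ → ℝ} (hf : ∀ t, 0 ≤ f t) : Monotone (partialSum f) :=
  monotone_nat_of_le_succ fun n => by rw [partialSum_succ]; linarith [hf (n + 1)]

theorem partialSum_nonneg {f : ℕ → ℝ} (hf : ∀ t, 0 ≤ f t) (n : ℕ) : 0 ≤ partialSum f n :=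
  Finset.sum_nonneg fun t _ => hf t

theorem partialSum_le {f : ℕ → ℝ} {B : ℝ} (hf : ∀ t, f t ≤ B) (n : ℕ) :
    partialSum f n ≤ n * B := by
  induction n with
  | zero => simp
  | succ n ih => rw [partialSum_succ]; push_cast; linarith [hf (n + 1)]

theorem partialSum_le_sub_two {f : ℕ → ℝ} {B : ℝ} (hf0 : ∀ t, 0 ≤ f t) (hf : ∀ t, f t ≤ B)
    (n : ℕ) : partialSum f n ≤ partialSum f (n - 2) + 2 * B := by
  have hB : 0 ≤ B := (hf0 0).trans (hf 0)
  match n with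
  | 0 => simp [hB]
  | 1 => simp [partialSum]; linarith [hf 1]
  | n + 2 =>
    rw [partialSum_succ, partialSum_succ]
    simp only [Nat.add_sub_cancel]
    linarith [hf (n + 1), hf (n + 1 + 1)]

/-- Factor `s` as a difference of squares of roots; the sum of the two roots is at most `2 * √b *
√y`, which cancels the normalization. Thus a lagging normalizer `y` still yields a telescoping
bound, at the price `√b`. -/
theorem mul_le_sqrt_sub_sqrt {x s y b c : ℝ} (hx : 0 ≤ x) (hs : 0 ≤ s) (hy : 0 < y)
    (hb : 0 ≤ b) (h : x + s ≤ b * y) (hc : c ≤ (√y)⁻¹) :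
    c * s ≤ 2 * √b * (√(x + s) - √x) := by
  have h1 : √(x + s) ≤ √b * √y := by
    rw [← Real.sqrt_mul hb]; exact Real.sqrt_le_sqrt h
  have hxs : √x ≤ √(x + s) := Real.sqrt_le_sqrt (by linarith)
  have h2 : s = (√(x + s) - √x) * (√(x + s) + √x) := by
    have e1 := Real.sq_sqrt hx
    have e2 := Real.sq_sqrt (add_nonneg hx hs)
    nlinarith
  have hy' : 0 < √y := Real.sqrt_pos.2 hy
  have h3 : √(x + s) + √x ≤ 2 * √b * √y := by linarith
  calc c * s ≤ (√y)⁻¹ * s := by gcongr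
    _ = (√y)⁻¹ * ((√(x + s) - √x) * (√(x + s) + √x)) := by rw [← h2]
    _ ≤ (√y)⁻¹ * ((√(x + s) - √x) * (2 * √b * √y)) := by
        have : 0 ≤ √(x + s) - √x := by linarith
        gcongr
    _ = 2 * √b * (√(x + s) - √x) := by field_simp

/-- A self-normalized sum with a normalization that lags behind by two steps. -/
theorem partialSum_mul_le {s c : ℕ → ℝ} {B : ℝ} (hs0 : ∀ t, 0 ≤ s t) (hsB : ∀ t, s t ≤ B)
    (hc : ∀ t, c t ≤ (√(1 + partialSum s (t - 2)))⁻¹) (n : ℕ) :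
    partialSum (fun t => c t * s t) n ≤ 2 * √(1 + 2 * B) * √(1 + partialSum s n) := by
  have hB : 0 ≤ B := (hs0 0).trans (hsB 0)
  induction n with
  | zero => simp only [partialSum_zero]; positivity
  | succ n ih =>
    have hS := partialSum_nonneg hs0 (n + 1 - 2)
    have h := mul_le_sqrt_sub_sqrt (x := 1 + partialSum s n) (s := s (n + 1))
      (y := 1 + partialSum s (n + 1 - 2)) (b := 1 + 2 * B) (c := c (n + 1))
      (by linarith [partialSum_nonneg hs0 n]) (hs0 _) (by linarith) (by linarith)
      (by
        -- The two terms missing from the normalizer add at most `2 * B`, and the normalizer is at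
        -- least 1, so the ratio is at most `1 + 2 * B`.
        have := partialSum_le_sub_two hs0 hsB (n + 1)
        rw [partialSum_succ] at this
        nlinarith) (hc _)
    rw [partialSum_succ, partialSum_succ]
    rw [add_assoc] at h
    linarith

/-- A self-normalized sum of the previous terms. -/
theorem partialSum_mul_pred_le {s c : ℕ → ℝ} {B : ℝ} (hs0 : ∀ t, 0 ≤ s t) (hsB : ∀ t, s t ≤ B)
    (hs : s 0 = 0) (hc : ∀ t, c t ≤ (√(1 + partialSum s (t - 2)))⁻¹) (n : ℕ) :
    partialSum (fun t => c t * s (t - 1)) (n + 1) ≤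
      2 * √(1 + 2 * B) * √(1 + partialSum s n) := by
  have hB : 0 ≤ B := (hs0 0).trans (hsB 0)
  induction n with
  | zero =>
    simp only [partialSum, zero_add, Finset.Icc_self, Finset.sum_singleton, Nat.sub_self, hs,
      mul_zero]
    positivity
  | succ n ih =>
    have hS := partialSum_nonneg hs0 n
    have h := mul_le_sqrt_sub_sqrt (x := 1 + partialSum s n) (s := s (n + 1))
      (y := 1 + partialSum s n) (b := 1 + 2 * B) (c := c (n + 2))
      (by linarith) (hs0 _) (by linarith) (by linarith)
      (by nlinarith [hsB (n + 1)]) (hc _)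
    rw [partialSum_succ, partialSum_succ s]
    rw [add_assoc] at h
    simp only [Nat.add_sub_cancel]
    linarith

/-! ### Dual averaging -/

/-- The quantity `1 + ∑_{s ≤ t - 2} (f s + ‖X_s - X_{s+1}‖²)`, the inverse square of the step
size. -/
def energy {E : Type*} [NormedAddCommGroup E] (f : ℕ → ℝ) (X : ℕ → E) (t : ℕ) : ℝ :=
  1 + (partialSum f (t - 2) + partialSum (fun s => ‖X s - X (s + 1)‖ ^ 2) (t - 2))

theorem energy_mono {E : Type*} [NormedAddCommGroup E] {f : ℕ → ℝ} (hf : ∀ t, 0 ≤ f t) (X : ℕ → E) :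
    Monotone (energy f X) := by
  intro s t hst
  have h1 := partialSum_mono hf (show s - 2 ≤ t - 2 by omega)
  have h2 := partialSum_mono (f := fun s => ‖X s - X (s + 1)‖ ^ 2) (fun t => by positivity)
    (show s - 2 ≤ t - 2 by omega)
  unfold energy
  linarith

theorem one_le_energy {E : Type*} [NormedAddCommGroup E] {f : ℕ → ℝ} (hf : ∀ t, 0 ≤ f t) (X : ℕ → E) (t : ℕ) :
    1 ≤ energy f X t := by
  have h1 := partialSum_nonneg hf (t - 2)
  have h2 := partialSum_nonneg (f := fun s => ‖X s - X (s + 1)‖ ^ 2) (fun t => by positivity)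
    (t - 2)
  unfold energy
  linarith

theorem stepSize_pos {E : Type*} [NormedAddCommGroup E] {X : ℕ → E}
    {η f : ℕ → ℝ} (hf : ∀ t, 0 ≤ f t) (hη : ∀ t, η t = (√(energy f X t))⁻¹) (t : ℕ) :
    0 < η t := by
  rw [hη]
  exact inv_pos.2 (Real.sqrt_pos.2 (zero_lt_one.trans_le (one_le_energy hf X t)))

theorem stepSize_antitone {E : Type*} [NormedAddCommGroup E] {X : ℕ → E}
    {η f : ℕ → ℝ} (hf : ∀ t, 0 ≤ f t) (hη : ∀ t, η t = (√(energy f X t))⁻¹) :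
    Antitone η := by
  intro s t hst
  rw [hη, hη]
  exact inv_anti₀ (Real.sqrt_pos.2 (zero_lt_one.trans_le (one_le_energy hf X s)))
    (Real.sqrt_le_sqrt (energy_mono hf X hst))

theorem stepSize_le_one {E : Type*} [NormedAddCommGroup E] {X : ℕ → E}
    {η f : ℕ → ℝ} (hf : ∀ t, 0 ≤ f t) (hη : ∀ t, η t = (√(energy f X t))⁻¹) (t : ℕ) :
    η t ≤ 1 := by
  rw [hη]
  exact inv_le_one_of_one_le₀ (Real.one_le_sqrt.2 (one_le_energy hf X t))

theorem stepSize_sq {E : Type*} [NormedAddCommGroup E] {X : ℕ → E}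
    {η f : ℕ → ℝ} (hf : ∀ t, 0 ≤ f t) (hη : ∀ t, η t = (√(energy f X t))⁻¹) (t : ℕ) :
    η t ^ 2 = (energy f X t)⁻¹ := by
  rw [hη, inv_pow, Real.sq_sqrt (zero_le_one.trans (one_le_energy hf X t))]

section DualAveraging

variable {E : Type*} [NormedAddCommGroup E] [InnerProductSpace ℝ E]

/-- Dual averaging with step sizes `η` for the feedback `v`, started at `x₁`. -/
structure IsDualAveraging (x₁ : E) (X Y v : ℕ → E) (η : ℕ → ℝ) : Prop where
  init : Y 1 = 0
  dual : ∀ t, 1 ≤ t → Y (t + 1) = Y t - v t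
  primal : ∀ t, 1 ≤ t → X t = x₁ + η t • Y t

/-- The potential is `η * ‖Y‖ ^ 2 / 2`. On expanding, the products `⟨Y, Y'⟩` cancel and only `η' ^ 2
/ η ≤ η'` is left, which is where decreasing step sizes enter. -/
theorem dualAveraging_step {Y Y' : E} {η η' : ℝ} (hη' : 0 < η') (hη : η' ≤ η) :
    inner ℝ (Y - Y') (η' • Y') + ‖η • Y - η' • Y'‖ ^ 2 / (2 * η) ≤
      η * ‖Y‖ ^ 2 / 2 - η' * ‖Y'‖ ^ 2 / 2 := by
  have hη0 : 0 < η := hη'.trans_le hη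
  have e1 : inner ℝ (Y - Y') (η' • Y') = η' * inner ℝ Y Y' - η' * ‖Y'‖ ^ 2 := by
    rw [inner_smul_right, inner_sub_left, real_inner_self_eq_norm_sq]; ring
  have e2 : ‖η • Y - η' • Y'‖ ^ 2 =
      η ^ 2 * ‖Y‖ ^ 2 - 2 * (η * (η' * inner ℝ Y Y')) + η' ^ 2 * ‖Y'‖ ^ 2 := by
    rw [norm_sub_sq_real, norm_smul, norm_smul, inner_smul_left, inner_smul_right, mul_pow,
      mul_pow, Real.norm_of_nonneg hη0.le, Real.norm_of_nonneg hη'.le]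
    simp
  have e3 : (η ^ 2 * ‖Y‖ ^ 2 - 2 * (η * (η' * inner ℝ Y Y')) + η' ^ 2 * ‖Y'‖ ^ 2) / (2 * η) =
      η * ‖Y‖ ^ 2 / 2 - η' * inner ℝ Y Y' + η' ^ 2 / η * ‖Y'‖ ^ 2 / 2 := by
    field_simp
  have e4 : η' ^ 2 / η ≤ η' := by
    rw [div_le_iff₀ hη0]; nlinarith
  have e5 : η' ^ 2 / η * ‖Y'‖ ^ 2 ≤ η' * ‖Y'‖ ^ 2 := by gcongr
  rw [e1, e2, e3]
  linarith

namespace IsDualAveraging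

variable {x₁ : E} {X Y v : ℕ → E} {η : ℕ → ℝ}

theorem dual_eq (h : IsDualAveraging x₁ X Y v η) (n : ℕ) :
    Y (n + 1) = -∑ t ∈ Finset.Icc 1 n, v t := by
  induction n with
  | zero => simp [h.init]
  | succ n ih =>
    rw [h.dual (n + 1) (by omega), ih, Finset.sum_Icc_succ_top (by omega)]
    abel

/-- The regret bound of dual averaging. -/
theorem regret_le (h : IsDualAveraging x₁ X Y v η) (hη0 : ∀ t, 0 < η t) (hη : Antitone η)
    (n : ℕ) (p : E) :
    partialSum (fun t => inner ℝ (v t) (X (t + 1) - p)) n ≤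
      ‖p - x₁‖ ^ 2 / (2 * η (n + 1)) -
        partialSum (fun t => ‖X t - X (t + 1)‖ ^ 2 / (2 * η t)) n := by
  -- Kept in this form the inequality telescopes in the potential; `p` is removed only at the end,
  -- by Young's inequality.
  have key : partialSum (fun t => inner ℝ (v t) (X (t + 1) - p)) n +
      partialSum (fun t => ‖X t - X (t + 1)‖ ^ 2 / (2 * η t)) n ≤
        inner ℝ (Y (n + 1)) (p - x₁) - η (n + 1) * ‖Y (n + 1)‖ ^ 2 / 2 := by
    induction n with
    | zero => simp [h.init]
    | succ n ih =>
      have hv : v (n + 1) = Y (n + 1) - Y (n + 2) := by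
        rw [h.dual (n + 1) (by omega)]; abel
      have hstep := dualAveraging_step (Y := Y (n + 1)) (Y' := Y (n + 2)) (hη0 (n + 2))
        (hη (show n + 1 ≤ n + 2 by omega))
      have e1 : X (n + 1) - X (n + 1 + 1) = η (n + 1) • Y (n + 1) - η (n + 2) • Y (n + 2) := by
        rw [h.primal (n + 1) (by omega), h.primal (n + 1 + 1) (by omega)]; abel
      have e2 : inner ℝ (v (n + 1)) (X (n + 1 + 1) - p) =
          inner ℝ (Y (n + 1) - Y (n + 2)) (η (n + 2) • Y (n + 2)) -
            inner ℝ (Y (n + 1)) (p - x₁) + inner ℝ (Y (n + 2)) (p - x₁) := by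
        have : X (n + 1 + 1) - p = η (n + 2) • Y (n + 2) - (p - x₁) := by
          rw [h.primal (n + 1 + 1) (by omega)]; abel
        rw [hv, this, inner_sub_right, inner_sub_left _ _ (p - x₁)]; ring
      rw [partialSum_succ, partialSum_succ, e1, e2]
      linarith
  have hη' := hη0 (n + 1)
  have hfin : inner ℝ (Y (n + 1)) (p - x₁) - η (n + 1) * ‖Y (n + 1)‖ ^ 2 / 2 ≤
      ‖p - x₁‖ ^ 2 / (2 * η (n + 1)) := by
    have hcs := real_inner_le_norm (Y (n + 1)) (p - x₁)
    have : ‖Y (n + 1)‖ * ‖p - x₁‖ - η (n + 1) * ‖Y (n + 1)‖ ^ 2 / 2 ≤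
        ‖p - x₁‖ ^ 2 / (2 * η (n + 1)) := by
      rw [le_div_iff₀ (by positivity)]
      nlinarith [sq_nonneg (‖p - x₁‖ - η (n + 1) * ‖Y (n + 1)‖)]
    linarith
  linarith

/-! ### Linear growth of the energy -/

variable {f : ℕ → ℝ} {κ B G : ℝ}

theorem norm_dual_le (h : IsDualAveraging x₁ X Y v η) (hv : ∀ t, ‖v t‖ ≤ G) (n : ℕ) :
    ‖Y (n + 1)‖ ≤ n * G := by
  rw [h.dual_eq, norm_neg]
  calc ‖∑ t ∈ Finset.Icc 1 n, v t‖ ≤ ∑ t ∈ Finset.Icc 1 n, ‖v t‖ := norm_sum_le _ _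
    _ ≤ ∑ t ∈ Finset.Icc 1 n, G := Finset.sum_le_sum fun t _ => hv t
    _ = n * G := by simp

theorem norm_dual_sq_le (h : IsDualAveraging x₁ X Y v η) (hv : ∀ t, ‖v t‖ ^ 2 ≤ κ * f t)
    (n : ℕ) : ‖Y (n + 1)‖ ^ 2 ≤ n * (κ * partialSum f n) := by
  rw [h.dual_eq, norm_neg]
  calc ‖∑ t ∈ Finset.Icc 1 n, v t‖ ^ 2 ≤ (∑ t ∈ Finset.Icc 1 n, ‖v t‖) ^ 2 := by
        gcongr; exact norm_sum_le _ _
    _ ≤ (Finset.Icc 1 n).card * ∑ t ∈ Finset.Icc 1 n, ‖v t‖ ^ 2 := sq_sum_le_card_mul_sum_sq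
    _ ≤ n * ∑ t ∈ Finset.Icc 1 n, κ * f t := by
        rw [Nat.card_Icc, Nat.add_sub_cancel]
        gcongr with t _
        exact hv t
    _ = n * (κ * partialSum f n) := by rw [partialSum, ← Finset.mul_sum]

/-- A move is fresh feedback, with weight at most 1, plus the shrinkage of the step size acting on
the accumulated dual vector. Only the second part can be large. -/
theorem norm_move_le (h : IsDualAveraging x₁ X Y v η) (hf : ∀ t, 0 ≤ f t)
    (hη : ∀ t, η t = (√(energy f X t))⁻¹) (hv : ∀ t, ‖v t‖ ≤ G) (n : ℕ) :
    ‖X (n + 1) - X (n + 2)‖ ≤ G + (η (n + 1) - η (n + 2)) * ‖Y (n + 1)‖ := by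
  have e : X (n + 1) - X (n + 2) =
      η (n + 2) • v (n + 1) + (η (n + 1) - η (n + 2)) • Y (n + 1) := by
    rw [h.primal (n + 1) (by omega), h.primal (n + 2) (by omega), h.dual (n + 1) (by omega),
      smul_sub, sub_smul]
    abel
  have h1 := stepSize_le_one hf hη (n + 2)
  have h2 := (stepSize_pos hf hη (n + 2)).le
  have h3 : 0 ≤ η (n + 1) - η (n + 2) :=
    sub_nonneg.2 (stepSize_antitone hf hη (show n + 1 ≤ n + 2 by omega))
  rw [e]
  refine (norm_add_le _ _).trans ?_
  rw [norm_smul, norm_smul, Real.norm_of_nonneg h2, Real.norm_of_nonneg h3]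
  have : η (n + 2) * ‖v (n + 1)‖ ≤ 1 * G := by
    gcongr
    exact hv _
  linarith

/-- The energy already contains the squared feedback up to the last term, which is at most `B`.
Cauchy–Schwarz bounds `‖Y‖ ^ 2` by `n` times that feedback, so the distance from the start grows
only like `√n`. -/
theorem stepSize_mul_norm_dual_sq_le (h : IsDualAveraging x₁ X Y v η) (hf : ∀ t, 0 ≤ f t)
    (hfB : ∀ t, f t ≤ B) (hη : ∀ t, η t = (√(energy f X t))⁻¹) (hκ : 0 ≤ κ)
    (hv : ∀ t, ‖v t‖ ^ 2 ≤ κ * f t) (n : ℕ) :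
    (η (n + 1) * ‖Y (n + 1)‖) ^ 2 ≤ n * (κ * (1 + B)) := by
  have hB : 0 ≤ B := (hf 0).trans (hfB 0)
  have ha := one_le_energy hf X (n + 1)
  have hS : partialSum f n ≤ (1 + B) * energy f X (n + 1) := by
    have hM := partialSum_nonneg (f := fun s => ‖X s - X (s + 1)‖ ^ 2) (fun t => by positivity)
      (n + 1 - 2)
    have h1 : partialSum f n ≤ partialSum f (n + 1 - 2) + B := by
      cases n with
      | zero => simp [hB]
      | succ n =>
        rw [partialSum_succ]
        have := hfB (n + 1)
        simpa using this
    have h2 : partialSum f (n + 1 - 2) + 1 ≤ energy f X (n + 1) := by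
      unfold energy; linarith
    nlinarith
  rw [mul_pow, stepSize_sq hf hη, inv_mul_le_iff₀ (by linarith)]
  refine (h.norm_dual_sq_le hv n).trans ?_
  calc (n : ℝ) * (κ * partialSum f n) ≤ n * (κ * ((1 + B) * energy f X (n + 1))) := by gcongr
    _ = energy f X (n + 1) * (n * (κ * (1 + B))) := by ring

/-- With bounded feedback, the energy of adaptive dual averaging grows at most linearly. -/
theorem sum_sq_move_le (h : IsDualAveraging x₁ X Y v η) (hf : ∀ t, 0 ≤ f t)
    (hfB : ∀ t, f t ≤ B) (hη : ∀ t, η t = (√(energy f X t))⁻¹) (hκ : 0 ≤ κ)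
    (hvG : ∀ t, ‖v t‖ ≤ G) (hv : ∀ t, ‖v t‖ ^ 2 ≤ κ * f t) {T : ℕ} (hT : 1 ≤ T) :
    partialSum (fun s => ‖X s - X (s + 1)‖ ^ 2) T ≤
      (1 + 8 * G ^ 2 + 4 * (κ * (1 + B))) * T := by
  have hB : 0 ≤ B := (hf 0).trans (hfB 0)
  have hG : 0 ≤ G := (norm_nonneg _).trans (hvG 0)
  have hT1 : (1 : ℝ) ≤ T := by exact_mod_cast hT
  set M : ℕ → ℝ := partialSum (fun s => ‖X s - X (s + 1)‖ ^ 2) with hM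
  set c : ℝ := κ * (1 + B) with hc
  have hc0 : 0 ≤ c := by positivity
  have hMmono : Monotone M := partialSum_mono fun t => by positivity
  have hMle : ∀ n, M n ≤ energy f X (n + 2) := by
    intro n
    have := partialSum_nonneg hf n
    simp only [energy, Nat.add_sub_cancel, ← hM]
    linarith
  have hsingle : ∀ n : ℕ, n < T → ‖X (n + 1) - X (n + 2)‖ ^ 2 ≤ (2 * G ^ 2 + 2 * c) * T := by
    intro n hn
    have h1 := h.norm_move_le hf hη hvG n
    have h2 := h.stepSize_mul_norm_dual_sq_le hf hfB hη hκ hv n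
    have h3 : (η (n + 1) - η (n + 2)) * ‖Y (n + 1)‖ ≤ η (n + 1) * ‖Y (n + 1)‖ := by
      have := (stepSize_pos hf hη (n + 2)).le
      gcongr; linarith
    have h4 : ‖X (n + 1) - X (n + 2)‖ ^ 2 ≤ (G + η (n + 1) * ‖Y (n + 1)‖) ^ 2 := by
      gcongr; linarith
    have h5 : (n : ℝ) ≤ T := by exact_mod_cast hn.le
    have h6 : (n : ℝ) * c ≤ T * c := by gcongr
    have h7 : G ^ 2 ≤ G ^ 2 * T := le_mul_of_one_le_right (by positivity) hT1
    nlinarith [sq_nonneg (G - η (n + 1) * ‖Y (n + 1)‖)]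
  -- If the energy never exceeds `T`, it bounds the moves directly. Otherwise the first time `τ` at
  -- which it does separates a phase with moves controlled by the energy from a phase with small
  -- steps.
  by_cases hex : ∃ t, (T : ℝ) < energy f X t
  swap
  · push Not at hex
    calc M T ≤ energy f X (T + 2) := hMle T
      _ ≤ T := hex _
      _ ≤ _ := by nlinarith [sq_nonneg G]
  classical
  obtain ⟨hτ, hmin⟩ := And.intro (Nat.find_spec hex) (fun m => Nat.find_min hex (m := m))
  set τ := Nat.find hex
  -- Up to index 2 the sums in the energy are empty, so it equals 1, which does not exceed `T`.
  have hτ3 : 3 ≤ τ := by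
    by_contra! hlt
    have h0 : τ - 2 = 0 := by omega
    simp only [energy, h0, partialSum_zero, add_zero] at hτ
    linarith
  obtain ⟨u, hu⟩ : ∃ u, τ = u + 3 := ⟨τ - 3, by omega⟩
  rw [hu] at hτ hmin
  have hMu : M u ≤ T := (hMle u).trans (not_lt.1 (hmin (u + 2) (by omega)))
  rcases le_or_gt T u with hTu | hTu
  · calc M T ≤ M u := hMmono hTu
      _ ≤ T := hMu
      _ ≤ _ := by nlinarith [sq_nonneg G]
  -- Because of the lag, the energy before `τ = u + 3` covers the moves up to `u` only, while the
  -- steps are small from `u + 3` on. The two moves in between are bounded one at a time.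
  have hMu1 : M (u + 1) ≤ T + (2 * G ^ 2 + 2 * c) * T := by
    have := hsingle u hTu
    have e : M (u + 1) = M u + ‖X (u + 1) - X (u + 1 + 1)‖ ^ 2 := partialSum_succ _ _
    rw [e]
    linarith
  rcases le_or_gt T (u + 1) with hTu' | hTu'
  · calc M T ≤ M (u + 1) := hMmono hTu'
      _ ≤ _ := hMu1
      _ ≤ _ := by nlinarith [sq_nonneg G]
  have hMu2 : M (u + 2) ≤ T + 2 * ((2 * G ^ 2 + 2 * c) * T) := by
    have := hsingle (u + 1) hTu'
    have e : M (u + 2) = M (u + 1) + ‖X (u + 1 + 1) - X (u + 1 + 2)‖ ^ 2 := partialSum_succ _ _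
    rw [e]
    linarith
  -- For a decreasing nonnegative sequence the squared decrement is at most the decrement of the
  -- squares, so the shrinkage terms telescope. After `τ` one has `η ^ 2 ≤ 1 / T`, and `(G * T) ^ 2
  -- / T` is linear in `T`.
  have hind : ∀ k : ℕ, u + 2 + k ≤ T → M (u + 2 + k) ≤ M (u + 2) + 2 * G ^ 2 * k +
      2 * (G * T) ^ 2 * (η (u + 3) ^ 2 - η (u + 3 + k) ^ 2) := by
    intro k
    induction k with
    | zero => intro _; simp
    | succ k ih =>
      intro hk
      have ih := ih (by omega)
      have e : M (u + 2 + (k + 1)) = M (u + 2 + k) +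
          ‖X (u + 2 + k + 1) - X (u + 2 + k + 2)‖ ^ 2 := partialSum_succ _ _
      have e1 : u + 3 + k = u + 2 + k + 1 := by omega
      have e2 : u + 3 + (k + 1) = u + 2 + k + 2 := by omega
      rw [e1] at ih
      rw [e, e2]
      set n := u + 2 + k
      have h1 := h.norm_move_le hf hη hvG n
      have h2 := h.norm_dual_le hvG n
      have hn : (n : ℝ) ≤ T := by exact_mod_cast (show n ≤ T by omega)
      have h3 : ‖Y (n + 1)‖ ≤ G * T := by nlinarith
      have h4 : 0 ≤ η (n + 1) - η (n + 2) :=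
        sub_nonneg.2 (stepSize_antitone hf hη (show n + 1 ≤ n + 2 by omega))
      have h5 : 0 < η (n + 2) := stepSize_pos hf hη _
      have h6 : ‖X (n + 1) - X (n + 2)‖ ^ 2 ≤ (G + (η (n + 1) - η (n + 2)) * (G * T)) ^ 2 := by
        gcongr
        refine h1.trans ?_
        gcongr
      have h7 : (η (n + 1) - η (n + 2)) ^ 2 ≤ η (n + 1) ^ 2 - η (n + 2) ^ 2 := by nlinarith
      have h8 : (G * T) ^ 2 * (η (n + 1) - η (n + 2)) ^ 2 ≤
          (G * T) ^ 2 * (η (n + 1) ^ 2 - η (n + 2) ^ 2) := by gcongr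
      push_cast
      nlinarith [sq_nonneg (G - (η (n + 1) - η (n + 2)) * (G * T))]
  obtain ⟨k, rfl⟩ : ∃ k, T = u + 2 + k := ⟨T - (u + 2), by omega⟩
  have hfin := hind k le_rfl
  have h1 : η (u + 3) ^ 2 ≤ ((u + 2 + k : ℕ) : ℝ)⁻¹ := by
    rw [stepSize_sq hf hη]
    exact inv_anti₀ (by linarith) hτ.le
  set T' : ℝ := ((u + 2 + k : ℕ) : ℝ) with hT'
  have h2 : (k : ℝ) ≤ T' := by rw [hT']; exact_mod_cast (by omega)
  have h3 : 2 * (G * T') ^ 2 * (η (u + 3) ^ 2 - η (u + 3 + k) ^ 2) ≤ 2 * G ^ 2 * T' := by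
    calc 2 * (G * T') ^ 2 * (η (u + 3) ^ 2 - η (u + 3 + k) ^ 2)
        ≤ 2 * (G * T') ^ 2 * T'⁻¹ := by
          gcongr
          nlinarith [sq_nonneg (η (u + 3 + k))]
      _ = 2 * G ^ 2 * T' := by field_simp
  have h4 : 2 * G ^ 2 * k ≤ 2 * G ^ 2 * T' := by gcongr
  linarith

/-- The step size decays at most like `1 / √T`. -/
theorem inv_stepSize_le (h : IsDualAveraging x₁ X Y v η) (hf : ∀ t, 0 ≤ f t)
    (hfB : ∀ t, f t ≤ B) (hη : ∀ t, η t = (√(energy f X t))⁻¹) (hκ : 0 ≤ κ)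
    (hvG : ∀ t, ‖v t‖ ≤ G) (hv : ∀ t, ‖v t‖ ^ 2 ≤ κ * f t) {T : ℕ} (hT : 1 ≤ T) :
    (η (T + 1))⁻¹ ≤ √(2 + B + 8 * G ^ 2 + 4 * (κ * (1 + B))) * √T := by
  have hB : 0 ≤ B := (hf 0).trans (hfB 0)
  have hT1 : (1 : ℝ) ≤ T := by exact_mod_cast hT
  rw [hη, inv_inv, ← Real.sqrt_mul (by positivity)]
  refine Real.sqrt_le_sqrt ((energy_mono hf X (show T + 1 ≤ T + 2 by omega)).trans ?_)
  have h1 := h.sum_sq_move_le hf hfB hη hκ hvG hv hT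
  have h2 := partialSum_le hfB T
  simp only [energy, Nat.add_sub_cancel]
  linarith

/-! ### Optimistic steps -/

/-- Here `w` is the previous feedback and `a'` its noiseless value. Splitting `⟨a, w⟩` around `a'`
leaves the variation of the operator, a favourable `‖a'‖ ^ 2` that is dropped, and products linear
in the errors `u` and `w - a'`. -/
theorem optimistic_step {x x' xh v u a a' w : E} {η γ Λ δ : ℝ} (hη : 0 < η) (hγ : 0 ≤ γ)
    (hxh : xh = x - γ • w) (hv : v = a + u) (hΛ : ‖a - a'‖ ≤ Λ) (hδ : δ = ‖x - x'‖) :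
    inner ℝ v (xh - x') ≤ η * ‖v‖ ^ 2 + δ ^ 2 / (4 * η) + γ * ‖w‖ * Λ
      - (inner ℝ u (γ • w) + γ * inner ℝ a' (w - a')) := by
  have e : inner ℝ v (xh - x') = inner ℝ v (x - x') - inner ℝ u (γ • w)
      - γ * inner ℝ a' (w - a') - γ * ‖a'‖ ^ 2 - γ * inner ℝ (a - a') w := by
    rw [hxh, hv, ← real_inner_self_eq_norm_sq]
    simp only [inner_add_left, inner_sub_left, inner_sub_right, inner_smul_right]
    ring
  have h1 : inner ℝ v (x - x') ≤ η * ‖v‖ ^ 2 + δ ^ 2 / (4 * η) := by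
    refine (real_inner_le_norm _ _).trans ?_
    rw [← hδ]
    have : ‖v‖ * δ - η * ‖v‖ ^ 2 ≤ δ ^ 2 / (4 * η) := by
      rw [le_div_iff₀ (by positivity)]
      nlinarith [sq_nonneg (δ - 2 * η * ‖v‖)]
    linarith
  have h2 : -(γ * inner ℝ (a - a') w) ≤ γ * ‖w‖ * Λ := by
    have h3 := (abs_le.1 (abs_real_inner_le_norm (a - a') w)).1
    have h4 : ‖a - a'‖ * ‖w‖ ≤ Λ * ‖w‖ := by gcongr
    have h5 : γ * (-inner ℝ (a - a') w) ≤ γ * (Λ * ‖w‖) := by gcongr; linarith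
    linarith
  have h6 : 0 ≤ γ * ‖a'‖ ^ 2 := by positivity
  linarith

/-- The regret bound of optimistic dual averaging with noisy feedback `v = a + u`. -/
theorem optimistic_regret_le (h : IsDualAveraging x₁ X Y v η) (hf : ∀ t, 0 ≤ f t)
    (hfB : ∀ t, f t ≤ B) (hη : ∀ t, η t = (√(energy f X t))⁻¹) (hκ : 0 ≤ κ)
    (hv : ∀ t, ‖v t‖ ^ 2 ≤ κ * f t) (hf0 : f 0 = 0) {L : ℝ} (hL : 0 ≤ L) {γ : ℕ → ℝ}
    {Xh a u : ℕ → E} (hγ0 : ∀ t, 0 ≤ γ t) (hγ : ∀ t, γ t ^ 2 ≤ (√(1 + partialSum f (t - 2)))⁻¹)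
    (hXh : ∀ t, 1 ≤ t → Xh t = X t - γ t • v (t - 1)) (hau : ∀ t, v t = a t + u t)
    (ha : ∀ t, 2 ≤ t → ‖a t - a (t - 1)‖ ≤ L * ‖Xh t - Xh (t - 1)‖) {T : ℕ} (hT : 1 ≤ T)
    (p : E) :
    partialSum (fun t => inner ℝ (v t) (Xh t - p)) T ≤
      ‖p - x₁‖ ^ 2 / (2 * η (T + 1)) +
        (1 + L) ^ 2 * (κ * (2 * √(1 + 2 * B) * √(1 + partialSum f T))) -
        partialSum (fun t => inner ℝ (u t) (γ t • v (t - 1)) +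
          γ t * inner ℝ (a (t - 1)) (u (t - 1))) T := by
  have hη0 := stepSize_pos hf hη
  have hv0 : v 0 = 0 := by
    have := hv 0
    rw [hf0, mul_zero] at this
    exact norm_eq_zero.1 (pow_eq_zero_iff two_ne_zero |>.1 (le_antisymm this (by positivity)))
  set w : ℕ → ℝ := fun t => γ t * ‖v (t - 1)‖ with hw
  set δ : ℕ → ℝ := fun t => ‖X t - X (t + 1)‖ with hδ
  set N : ℕ → ℝ := fun t => inner ℝ (u t) (γ t • v (t - 1)) +
    γ t * inner ℝ (a (t - 1)) (u (t - 1)) with hN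
  have hu : ∀ t, u t = v t - a t := fun t => eq_sub_of_add_eq' (hau t).symm
  -- The two negative terms at time `T` are a reserve carried through the induction: they pay for
  -- the part of the next operator variation that is due to the last move and the last
  -- extrapolation.
  have key : partialSum (fun t => inner ℝ (v t) (Xh t - X (t + 1))) T ≤
      partialSum (fun t => δ t ^ 2 / (2 * η t)) T - δ T ^ 2 / (4 * η T) +
        partialSum (fun t => η t * ‖v t‖ ^ 2) T +
        (L ^ 2 + 2 * L) * partialSum (fun t => w t ^ 2) T - L / 2 * w T ^ 2 -
        partialSum N T := by
    induction T, hT using Nat.le_induction with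
    | base =>
      have hstep := optimistic_step (x := X 1) (x' := X 2) (xh := Xh 1) (v := v 1) (u := u 1)
        (a := a 1) (a' := a 0) (w := v 0) (hη0 1) (hγ0 1) (hXh 1 le_rfl) (hau 1) le_rfl rfl
      rw [← hu 0] at hstep
      have h1 : w 1 = 0 := by simp [hw, hv0]
      rw [hv0, norm_zero, mul_zero, zero_mul, ← hv0] at hstep
      have e : δ 1 ^ 2 / (2 * η 1) - δ 1 ^ 2 / (4 * η 1) = δ 1 ^ 2 / (4 * η 1) := by
        have := (hη0 1).ne'
        field_simp; ring
      simp only [partialSum, Finset.Icc_self, Finset.sum_singleton, h1, hN]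
      simp only [hδ] at e ⊢
      norm_num at hstep ⊢
      linarith
    | succ n hn ih =>
      obtain ⟨m, rfl⟩ : ∃ m, n = m + 1 := ⟨n - 1, by omega⟩
      have hstep := optimistic_step (x := X (m + 2)) (x' := X (m + 3)) (xh := Xh (m + 2))
        (v := v (m + 2)) (u := u (m + 2)) (a := a (m + 2)) (a' := a (m + 1)) (w := v (m + 1))
        (hη0 (m + 2)) (hγ0 _) (hXh _ (by omega)) (hau _) (ha _ (by omega)) rfl
      rw [← hu] at hstep
      have hdist : ‖Xh (m + 2) - Xh (m + 1)‖ ≤ δ (m + 1) + w (m + 2) + w (m + 1) := by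
        have e : Xh (m + 2) - Xh (m + 1) =
            -(X (m + 1) - X (m + 2)) - γ (m + 2) • v (m + 1) + γ (m + 1) • v m := by
          rw [hXh _ (by omega), hXh (m + 1) (by omega)]
          simp only [Nat.add_sub_cancel, show m + 2 - 1 = m + 1 by omega]
          abel
        rw [e]
        refine (norm_add_le _ _).trans (add_le_add ((norm_sub_le _ _).trans ?_) ?_)
        · rw [norm_neg, norm_smul, Real.norm_of_nonneg (hγ0 _)]; rfl
        · rw [norm_smul, Real.norm_of_nonneg (hγ0 _)]; rfl
      have hδ0 : 0 ≤ δ (m + 1) := norm_nonneg _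
      have hw0 : 0 ≤ w (m + 2) := mul_nonneg (hγ0 _) (norm_nonneg _)
      -- Young's inequality for the products with the move and with the previous extrapolation; `η ≤
      -- 1` lets the reserve absorb the former.
      have hcross : γ (m + 2) * ‖v (m + 1)‖ * (L * ‖Xh (m + 2) - Xh (m + 1)‖) ≤
          δ (m + 1) ^ 2 / (4 * η (m + 1)) + (L ^ 2 + 2 * L) * w (m + 2) ^ 2 -
            L / 2 * w (m + 2) ^ 2 + L / 2 * w (m + 1) ^ 2 := by
        have h1 : w (m + 2) * (L * ‖Xh (m + 2) - Xh (m + 1)‖) ≤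
            w (m + 2) * (L * (δ (m + 1) + w (m + 2) + w (m + 1))) := by gcongr
        have h2 : δ (m + 1) ^ 2 / 4 ≤ δ (m + 1) ^ 2 / (4 * η (m + 1)) := by
          have := stepSize_le_one hf hη (m + 1)
          have := hη0 (m + 1)
          gcongr
          linarith
        have h3 : 0 ≤ L * (w (m + 2) - w (m + 1)) ^ 2 := by positivity
        change w (m + 2) * _ ≤ _
        nlinarith [sq_nonneg (L * w (m + 2) - δ (m + 1) / 2)]
      have e : δ (m + 2) ^ 2 / (2 * η (m + 2)) - δ (m + 2) ^ 2 / (4 * η (m + 2)) =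
          δ (m + 2) ^ 2 / (4 * η (m + 2)) := by
        have := (hη0 (m + 2)).ne'
        field_simp; ring
      have e2 : N (m + 1 + 1) = inner ℝ (u (m + 2)) (γ (m + 2) • v (m + 1)) +
          γ (m + 2) * inner ℝ (a (m + 1)) (u (m + 1)) := rfl
      have e3 : δ (m + 2) = ‖X (m + 2) - X (m + 3)‖ := rfl
      simp only [partialSum_succ _ (m + 1), e2]
      rw [← e3, show m + 2 - 1 = m + 1 by omega] at hstep
      simp only [show m + 1 + 1 = m + 2 by omega, show m + 2 + 1 = m + 3 by omega] at *
      linarith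
  have hη1 : partialSum (fun t => η t * ‖v t‖ ^ 2) T ≤
      κ * (2 * √(1 + 2 * B) * √(1 + partialSum f T)) := by
    have h1 := partialSum_mul_le (s := f) (c := η) hf hfB (fun t => by
      rw [hη]
      have := partialSum_nonneg hf (t - 2)
      refine inv_anti₀ (Real.sqrt_pos.2 (by linarith)) (Real.sqrt_le_sqrt ?_)
      have := partialSum_nonneg (f := fun s => ‖X s - X (s + 1)‖ ^ 2) (fun t => by positivity)
        (t - 2)
      unfold energy; linarith) T
    calc partialSum (fun t => η t * ‖v t‖ ^ 2) T
        ≤ partialSum (fun t => κ * (η t * f t)) T := by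
          refine Finset.sum_le_sum fun t _ => ?_
          have := mul_le_mul_of_nonneg_left (hv t) (hη0 t).le
          linarith
      _ = κ * partialSum (fun t => η t * f t) T := (Finset.mul_sum _ _ _).symm
      _ ≤ _ := by gcongr
  have hw1 : partialSum (fun t => w t ^ 2) T ≤
      κ * (2 * √(1 + 2 * B) * √(1 + partialSum f T)) := by
    obtain ⟨m, rfl⟩ : ∃ m, T = m + 1 := ⟨T - 1, by omega⟩
    have h1 := partialSum_mul_pred_le (s := f) (c := fun t => γ t ^ 2) hf hfB hf0 hγ m
    have h2 := partialSum_mono hf (show m ≤ m + 1 by omega)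
    calc partialSum (fun t => w t ^ 2) (m + 1)
        ≤ partialSum (fun t => κ * (γ t ^ 2 * f (t - 1))) (m + 1) := by
          refine Finset.sum_le_sum fun t _ => ?_
          have := mul_le_mul_of_nonneg_left (hv (t - 1)) (sq_nonneg (γ t))
          simp only [hw, mul_pow]
          linarith
      _ = κ * partialSum (fun t => γ t ^ 2 * f (t - 1)) (m + 1) := (Finset.mul_sum _ _ _).symm
      _ ≤ κ * (2 * √(1 + 2 * B) * √(1 + partialSum f m)) := by gcongr
      _ ≤ _ := by gcongr
  have hda := h.regret_le hη0 (stepSize_antitone hf hη) T p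
  have hsplit : partialSum (fun t => inner ℝ (v t) (Xh t - p)) T =
      partialSum (fun t => inner ℝ (v t) (Xh t - X (t + 1))) T +
        partialSum (fun t => inner ℝ (v t) (X (t + 1) - p)) T := by
    unfold partialSum
    rw [← Finset.sum_add_distrib]
    refine Finset.sum_congr rfl fun t _ => ?_
    rw [← inner_add_right, sub_add_sub_cancel]
  have h1 : 0 ≤ δ T ^ 2 / (4 * η T) := by
    have := hη0 T
    positivity
  have h2 : 0 ≤ L / 2 * w T ^ 2 := by positivity
  have h3 : (L ^ 2 + 2 * L) * partialSum (fun t => w t ^ 2) T ≤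
      (L ^ 2 + 2 * L) * (κ * (2 * √(1 + 2 * B) * √(1 + partialSum f T))) := by gcongr
  rw [hsplit]
  linarith

end IsDualAveraging

end DualAveraging

end

noncomputable section

/-! ### Fresh samples -/

instance {d K : ℕ} {Ξ : Type*} [MeasurableSpace Ξ] (P : Measure Ξ) [IsProbabilityMeasure P] :
    IsProbabilityMeasure (sampleLaw d K P) := by
  unfold sampleLaw; infer_instance

namespace IsFreshSampling

variable {d K : ℕ} {Ξ Ω E : Type*} [MeasurableSpace Ξ] [mΩ : MeasurableSpace Ω]
  [MeasurableSpace E] {μ : Measure Ω} {P : Measure Ξ} {ℱ : Filtration ℕ mΩ} {ζ : ℕ → Ω → Fin K → Ξ × (Fin d → ℝ)}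

theorem measurable (h : IsFreshSampling μ P ℱ ζ) (t : ℕ) : Measurable (ζ (t + 1)) :=
  (h.adapted t).mono (ℱ.le _) le_rfl

variable [IsProbabilityMeasure μ]

theorem map_prod (h : IsFreshSampling μ P ℱ ζ) {t : ℕ} {Ψ : Ω → E} (hΨ : Measurable[ℱ t] Ψ) :
    μ.map (fun ω => (Ψ ω, ζ (t + 1) ω)) = (μ.map Ψ).prod (sampleLaw d K P) := by
  have hΨ' : Measurable Ψ := hΨ.mono (ℱ.le _) le_rfl
  rw [← h.law t]
  refine (indepFun_iff_map_prod_eq_prod_map_map hΨ'.aemeasurable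
    (h.measurable t).aemeasurable).1 ?_
  rw [IndepFun_iff_Indep]
  exact (indep_of_indep_of_le_right (h.indep t) hΨ.comap_le).symm

variable [IsProbabilityMeasure P]

/-- The exceptional null set may depend on the point; as the sample is independent of the past,
Fubini allows a random point known beforehand to be substituted. -/
theorem ae_of_forall_ae (h : IsFreshSampling μ P ℱ ζ) {t : ℕ} {Ψ : Ω → E}
    (hΨ : Measurable[ℱ t] Ψ) {p : E × (Fin K → Ξ × (Fin d → ℝ)) → Prop}
    (hp : MeasurableSet {x | p x}) (hae : ∀ ψ, ∀ᵐ z ∂sampleLaw d K P, p (ψ, z)) :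
    ∀ᵐ ω ∂μ, p (Ψ ω, ζ (t + 1) ω) := by
  have hΨ' : Measurable Ψ := hΨ.mono (ℱ.le _) le_rfl
  have h1 : ∀ᵐ x ∂(μ.map Ψ).prod (sampleLaw d K P), p x :=
    (Measure.ae_prod_iff_ae_ae hp).2 (Filter.Eventually.of_forall hae)
  rw [← h.map_prod hΨ] at h1
  exact (ae_map_iff (hΨ'.prodMk (h.measurable t)).aemeasurable hp).1 h1

/-- The past and the fresh sample have a product law, so one integrates over the sample first with
the past frozen. This replaces conditional expectations. -/
theorem integral_eq_zero (h : IsFreshSampling μ P ℱ ζ) {t : ℕ} {Ψ : Ω → E}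
    (hΨ : Measurable[ℱ t] Ψ) {f : E × (Fin K → Ξ × (Fin d → ℝ)) → ℝ} (hf : Measurable f)
    (hint : Integrable (fun ω => f (Ψ ω, ζ (t + 1) ω)) μ)
    (hzero : ∀ ω, ∫ z, f (Ψ ω, z) ∂sampleLaw d K P = 0) :
    ∫ ω, f (Ψ ω, ζ (t + 1) ω) ∂μ = 0 := by
  have hΨ' : Measurable Ψ := hΨ.mono (ℱ.le _) le_rfl
  have hm : Measurable fun ω => (Ψ ω, ζ (t + 1) ω) := hΨ'.prodMk (h.measurable t)
  have : IsProbabilityMeasure (μ.map Ψ) := Measure.isProbabilityMeasure_map hΨ'.aemeasurable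
  have h1 : Integrable f ((μ.map Ψ).prod (sampleLaw d K P)) := by
    rw [← h.map_prod hΨ]
    exact (integrable_map_measure hf.aestronglyMeasurable hm.aemeasurable).2 hint
  rw [← integral_map (φ := fun ω => (Ψ ω, ζ (t + 1) ω)) hm.aemeasurable hf.aestronglyMeasurable,
    h.map_prod hΨ, integral_prod f h1, integral_map hΨ'.aemeasurable]
  · simp [hzero]
  · exact (StronglyMeasurable.integral_prod_right
      (f := fun x y => f (x, y)) hf.stronglyMeasurable).aestronglyMeasurable

end IsFreshSampling

/-! ### Quantized oracles -/

section Oracle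

variable {d K M q : ℕ} {Ξ : Type*} [MeasurableSpace Ξ] {P : Measure Ξ} [IsProbabilityMeasure P]
  {α : Fin M → ℕ} {typ : Fin d → Fin M} {J : ℝ}

theorem measurePreserving_node (P : Measure Ξ) [IsProbabilityMeasure P] (k : Fin K) :
    MeasurePreserving (Function.eval k) (sampleLaw d K P) (P.prod (roundingLaw d)) :=
  measurePreserving_eval (fun _ : Fin K => P.prod (roundingLaw d)) k

theorem AlmostSurelyBounded.ae_sampleLaw {g : Vec d → Ξ → Vec d} (h : AlmostSurelyBounded P g J)
    (x : Vec d) (k : Fin K) : ∀ᵐ z ∂sampleLaw d K P, ‖g x (z k).1‖ ≤ J :=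
  (measurePreserving_node P k).quasiMeasurePreserving.ae
    (Measure.quasiMeasurePreserving_fst.ae (h x))

theorem integrable_quantize_oracle (hq : 1 ≤ q) {l : (m : Fin M) → Fin (α m + 2) → ℝ}
    (hl : ∀ m, IsLevelSeq (l m)) {h : Ξ → Vec d} (hm : Measurable h)
    (hb : ∀ᵐ ξ ∂P, ‖h ξ‖ ≤ J) :
    Integrable (fun y : Ξ × (Fin d → ℝ) => quantize q typ l (h y.1) y.2)
      (P.prod (roundingLaw d)) := by
  have hmeas : Measurable fun y : Ξ × (Fin d → ℝ) => quantize q typ l (h y.1) y.2 :=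
    measurable_quantize q typ measurable_const (hm.comp measurable_fst) measurable_snd
  refine Integrable.of_bound hmeas.aestronglyMeasurable (d ^ 2 * J) ?_
  filter_upwards [Measure.quasiMeasurePreserving_fst.ae hb] with y hy
  exact (norm_quantize_le hq hl _ _).trans (by gcongr)

theorem integral_quantize_oracle (hq : 1 ≤ q) {l : (m : Fin M) → Fin (α m + 2) → ℝ}
    (hl : ∀ m, IsLevelSeq (l m)) {h : Ξ → Vec d} (hm : Measurable h)
    (hb : ∀ᵐ ξ ∂P, ‖h ξ‖ ≤ J) (hint : Integrable h P) :
    ∫ y, quantize q typ l (h y.1) y.2 ∂P.prod (roundingLaw d) = ∫ ξ, h ξ ∂P := by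
  have hI := integrable_quantize_oracle (typ := typ) hq hl hm hb
  have hIi : ∀ i, Integrable (fun y : Ξ × (Fin d → ℝ) => quantize q typ l (h y.1) y.2 i)
      (P.prod (roundingLaw d)) := fun i => (EuclideanSpace.proj (𝕜 := ℝ) i).integrable_comp hI
  have hhi : ∀ i, Integrable (fun ξ => h ξ i) P :=
    fun i => (EuclideanSpace.proj (𝕜 := ℝ) i).integrable_comp hint
  ext i
  rw [eval_integral_piLp hIi, eval_integral_piLp hhi, integral_prod _ (hIi i)]
  simp_rw [integral_quantize_apply hq hl]

theorem integral_nodeAvg_quantize (hK : 1 ≤ K) (hq : 1 ≤ q)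
    {l : (m : Fin M) → Fin (α m + 2) → ℝ} (hl : ∀ m, IsLevelSeq (l m)) {h : Fin K → Ξ → Vec d}
    (hm : ∀ k, Measurable (h k)) (hb : ∀ k, ∀ᵐ ξ ∂P, ‖h k ξ‖ ≤ J) {a : Vec d}
    (hint : ∀ k, Integrable (h k) P ∧ ∫ ξ, h k ξ ∂P = a) (y : Vec d) :
    ∫ z, inner ℝ (nodeAvg (fun k => quantize q typ l (h k (z k).1) (z k).2) - a) y
      ∂sampleLaw d K P = 0 := by
  have hI : ∀ k, Integrable (fun z : Fin K → Ξ × (Fin d → ℝ) =>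
      quantize q typ l (h k (z k).1) (z k).2) (sampleLaw d K P) := fun k =>
    (measurePreserving_node P k).integrable_comp_of_integrable
      (integrable_quantize_oracle (typ := typ) hq hl (hm k) (hb k))
  have hE : ∀ k, ∫ z, quantize q typ l (h k (z k).1) (z k).2 ∂sampleLaw d K P = a := by
    intro k
    rw [← (hint k).2, ← integral_quantize_oracle (typ := typ) hq hl (hm k) (hb k) (hint k).1,
      ← (measurePreserving_node P k).map_eq, integral_map
        (measurePreserving_node P k).measurable.aemeasurable]
    rw [(measurePreserving_node P k).map_eq]
    exact (integrable_quantize_oracle (typ := typ) hq hl (hm k) (hb k)).aestronglyMeasurable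
  have hIs : Integrable (fun z : Fin K → Ξ × (Fin d → ℝ) =>
      nodeAvg fun k => quantize q typ l (h k (z k).1) (z k).2) (sampleLaw d K P) :=
    (integrable_finsetSum Finset.univ fun k _ => hI k).smul (K : ℝ)⁻¹
  have hK' : (K : ℝ) ≠ 0 := by positivity
  have hEs : ∫ z, nodeAvg (fun k => quantize q typ l (h k (z k).1) (z k).2)
      ∂sampleLaw d K P = a := by
    unfold nodeAvg
    rw [integral_smul, integral_finsetSum _ fun k _ => hI k]
    simp only [hE, Finset.sum_const, Finset.card_univ, Fintype.card_fin]
    rw [← Nat.cast_smul_eq_nsmul ℝ, smul_smul, inv_mul_cancel₀ hK', one_smul]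
  simp_rw [fun z : Fin K → Ξ × (Fin d → ℝ) => real_inner_comm y (nodeAvg (fun k =>
    quantize q typ l (h k (z k).1) (z k).2) - a)]
  refine (integral_inner (𝕜 := ℝ) (hIs.sub (integrable_const a)) y).trans ?_
  rw [integral_sub' hIs (integrable_const a), hEs]
  simp

end Oracle

/-! ### Node averages -/

section NodeAvg

variable {d K : ℕ}

/-- The sum `∑_k ‖V_k‖² / K²`. -/
def normSqDual (V : Fin K → Vec d) : ℝ := ∑ k, ‖V k‖ ^ 2 / (K : ℝ) ^ 2

theorem normSqDual_nonneg (V : Fin K → Vec d) : 0 ≤ normSqDual V :=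
  Finset.sum_nonneg fun _ _ => by positivity

theorem sumSqDual_eq_partialSum (Vh : ℕ → Fin K → Vec d) (n : ℕ) :
    sumSqDual Vh n = partialSum (fun t => normSqDual (Vh t)) n := rfl

theorem normSqDual_le (hK : 1 ≤ K) {V : Fin K → Vec d} {G : ℝ} (hV : ∀ k, ‖V k‖ ≤ G) :
    normSqDual V ≤ G ^ 2 := by
  have hK1 : (1 : ℝ) ≤ K := by exact_mod_cast hK
  calc normSqDual V ≤ ∑ _k : Fin K, G ^ 2 / (K : ℝ) ^ 2 :=
        Finset.sum_le_sum fun k _ => by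
          have := hV k
          gcongr
    _ = G ^ 2 / K := by simp; field_simp
    _ ≤ G ^ 2 := div_le_self (by positivity) hK1

theorem norm_nodeAvg_le (hK : 1 ≤ K) {V : Fin K → Vec d} {G : ℝ} (hV : ∀ k, ‖V k‖ ≤ G) :
    ‖nodeAvg V‖ ≤ G := by
  have hK0 : (0 : ℝ) < K := by exact_mod_cast hK
  rw [nodeAvg, norm_smul, norm_inv, Real.norm_natCast, inv_mul_le_iff₀ hK0]
  calc ‖∑ k, V k‖ ≤ ∑ k, ‖V k‖ := norm_sum_le _ _
    _ ≤ ∑ _k : Fin K, G := Finset.sum_le_sum fun k _ => hV k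
    _ = K * G := by simp

/-- Cauchy–Schwarz over the nodes; this is the source of `κ = K` in the abstract estimates. -/
theorem norm_nodeAvg_sq_le (V : Fin K → Vec d) : ‖nodeAvg V‖ ^ 2 ≤ K * normSqDual V := by
  rw [nodeAvg, norm_smul, norm_inv, Real.norm_natCast, mul_pow, normSqDual, ← Finset.sum_div]
  calc (K : ℝ)⁻¹ ^ 2 * ‖∑ k, V k‖ ^ 2 ≤ (K : ℝ)⁻¹ ^ 2 * (K * ∑ k, ‖V k‖ ^ 2) := by
        gcongr
        calc ‖∑ k, V k‖ ^ 2 ≤ (∑ k, ‖V k‖) ^ 2 := by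
              gcongr; exact norm_sum_le _ _
          _ ≤ (Finset.univ : Finset (Fin K)).card * ∑ k, ‖V k‖ ^ 2 := sq_sum_le_card_mul_sum_sq
          _ = _ := by simp
    _ = _ := by ring

theorem measurable_nodeAvg {β : Type*} [MeasurableSpace β] {V : β → Fin K → Vec d}
    (hV : Measurable V) : Measurable fun b => nodeAvg (V b) := by
  unfold nodeAvg
  fun_prop

theorem measurable_sumSqDual {β : Type*} [MeasurableSpace β] {Vh : ℕ → β → Fin K → Vec d} {n : ℕ}
    (hV : ∀ t ≤ n, Measurable (Vh t)) : Measurable fun b => sumSqDual (fun t => Vh t b) n := by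
  unfold sumSqDual
  refine Finset.measurable_fun_sum _ fun s hs => ?_
  have := hV s (Finset.mem_Icc.1 hs).2
  fun_prop

theorem measurable_sumSqMove {β : Type*} [MeasurableSpace β] {X : ℕ → β → Vec d} {n : ℕ}
    (hX : ∀ t ≤ n, Measurable (X (t + 1))) :
    Measurable fun b => sumSqMove (fun t => X t b) n := by
  unfold sumSqMove
  refine Finset.measurable_fun_sum _ fun s hs => ?_
  obtain ⟨h1, h2⟩ := Finset.mem_Icc.1 hs
  obtain ⟨r, rfl⟩ : ∃ r, s = r + 1 := ⟨s - 1, by omega⟩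
  have h3 := hX r (by omega)
  have h4 := hX (r + 1) h2
  fun_prop

theorem measurable_gammaAlt {β : Type*} [MeasurableSpace β] (qhat : ℝ)
    {Vh : ℕ → β → Fin K → Vec d} {n : ℕ} (hV : ∀ t, t + 2 ≤ n → Measurable (Vh t))
    (hV0 : Measurable (Vh 0)) :
    Measurable fun b => gammaAlt qhat (fun t => Vh t b) n := by
  have := measurable_sumSqDual (Vh := Vh) (n := n - 2) fun t ht => by
    rcases Nat.eq_zero_or_pos t with rfl | h
    · exact hV0
    · exact hV t (by omega)
  unfold gammaAlt
  fun_prop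

theorem gammaAlt_nonneg (qhat : ℝ) (Vh : ℕ → Fin K → Vec d) (t : ℕ) :
    0 ≤ gammaAlt qhat Vh t := by
  refine Real.rpow_nonneg ?_ _
  rw [sumSqDual_eq_partialSum]
  linarith [partialSum_nonneg (fun t => normSqDual_nonneg (Vh t)) (t - 2)]

theorem gammaAlt_le_one {qhat : ℝ} (hq : qhat ≤ 1 / 4) (Vh : ℕ → Fin K → Vec d) (t : ℕ) :
    gammaAlt qhat Vh t ≤ 1 := by
  refine Real.rpow_le_one_of_one_le_of_nonpos ?_ (by linarith)
  rw [sumSqDual_eq_partialSum]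
  linarith [partialSum_nonneg (fun t => normSqDual_nonneg (Vh t)) (t - 2)]

/-- The base is at least 1 and `2 * (qhat - 1 / 2) ≤ -1 / 2` exactly when `qhat ≤ 1 / 4`. Squared
extrapolations are thus self-normalized like the dual steps. -/
theorem gammaAlt_sq_le {qhat : ℝ} (hq : qhat ≤ 1 / 4) (Vh : ℕ → Fin K → Vec d) (t : ℕ) :
    gammaAlt qhat Vh t ^ 2 ≤ (√(1 + partialSum (fun t => normSqDual (Vh t)) (t - 2)))⁻¹ := by
  have h := partialSum_nonneg (fun t => normSqDual_nonneg (Vh t)) (t - 2)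
  rw [gammaAlt, sumSqDual_eq_partialSum, ← Real.rpow_natCast, ← Real.rpow_mul (by linarith),
    Real.sqrt_eq_rpow, ← Real.rpow_neg (by linarith)]
  exact Real.rpow_le_rpow_of_exponent_le (by linarith) (by push_cast; linarith)

theorem etaAlt_eq (X : ℕ → Vec d) (Vh : ℕ → Fin K → Vec d) (t : ℕ) :
    etaAlt X Vh t = (√(energy (fun t => normSqDual (Vh t)) X t))⁻¹ := by
  have h := one_le_energy (fun t => normSqDual_nonneg (Vh t)) X t
  rw [Real.sqrt_eq_rpow, ← Real.rpow_neg (by linarith)]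
  rfl

end NodeAvg

/-! ### QODA as an instance of dual averaging -/

namespace IsQODARun

variable {d K M q : ℕ} {Ξ : Type*} {α : Fin M → ℕ} {typ : Fin d → Fin M} {qhat : ℝ}
  {g : Fin K → Vec d → Ξ → Vec d} {x₁ : Vec d} {lev : ℕ → (m : Fin M) → Fin (α m + 2) → ℝ}
  {ζ : ℕ → Fin K → Ξ × (Fin d → ℝ)} {X Xh Y : ℕ → Vec d} {Vh : ℕ → Fin K → Vec d}

theorem isDualAveraging (h : IsQODARun q typ qhat g x₁ lev ζ X Xh Y Vh) :
    IsDualAveraging x₁ X Y (fun t => nodeAvg (Vh t)) (etaAlt X Vh) where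
  init := h.init_Y
  dual := h.dual
  primal t ht := by
    obtain ⟨r, rfl⟩ : ∃ r, t = r + 1 := ⟨t - 1, by omega⟩
    rcases Nat.eq_zero_or_pos r with rfl | hr
    · simp [h.init_X, h.init_Y]
    · exact h.update r hr

theorem etaAlt_le_one (X : ℕ → Vec d) (Vh : ℕ → Fin K → Vec d) (t : ℕ) :
    0 ≤ etaAlt X Vh t ∧ etaAlt X Vh t ≤ 1 :=
  ⟨(stepSize_pos (fun t => normSqDual_nonneg (Vh t)) (etaAlt_eq X Vh) t).le,
    stepSize_le_one (fun t => normSqDual_nonneg (Vh t)) (etaAlt_eq X Vh) t⟩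

/-- The extrapolated iterates stay within a distance linear in time of the starting point. -/
theorem norm_extrapolate_sub_le (h : IsQODARun q typ qhat g x₁ lev ζ X Xh Y Vh) (hK : 1 ≤ K)
    (hqhat : qhat ≤ 1 / 4) {G : ℝ} (hV : ∀ t k, ‖Vh t k‖ ≤ G) (t : ℕ) :
    ‖Xh (t + 1) - x₁‖ ≤ (t + 1) * G := by
  have hda := h.isDualAveraging
  have hv : ∀ t, ‖nodeAvg (Vh t)‖ ≤ G := fun t => norm_nodeAvg_le hK (hV t)
  have h1 := hda.norm_dual_le hv t
  have h2 := etaAlt_le_one X Vh (t + 1)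
  have h3 := gammaAlt_nonneg qhat Vh (t + 1)
  have h4 := gammaAlt_le_one hqhat Vh (t + 1)
  have e : Xh (t + 1) - x₁ = etaAlt X Vh (t + 1) • Y (t + 1) -
      gammaAlt qhat Vh (t + 1) • nodeAvg (Vh t) := by
    rw [h.extrapolate _ (by omega), hda.primal _ (by omega), Nat.add_sub_cancel]
    abel
  rw [e]
  refine (norm_sub_le _ _).trans ?_
  rw [norm_smul, norm_smul, Real.norm_of_nonneg h2.1, Real.norm_of_nonneg h3]
  have h5 : etaAlt X Vh (t + 1) * ‖Y (t + 1)‖ ≤ 1 * (t * G) := by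
    gcongr
    exact h2.2
  have h6 : gammaAlt qhat Vh (t + 1) * ‖nodeAvg (Vh t)‖ ≤ 1 * G := by
    gcongr
    exact hv t
  linarith

end IsQODARun

end

noncomputable section

/-! ### The gap function -/

section Gap

variable {d : ℕ} {A : Vec d → Vec d} {𝒳 : Set (Vec d)} {J : ℝ}

theorem bddAbove_gap (hA : ∀ x, ‖A x‖ ≤ J) (h𝒳 : IsCompact 𝒳) (x : Vec d) :
    BddAbove (Set.range fun p : 𝒳 => inner ℝ (A p) (x - p)) := by
  obtain ⟨R, hR⟩ := h𝒳.isBounded.exists_norm_le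
  have hJ : 0 ≤ J := (norm_nonneg _).trans (hA 0)
  refine ⟨J * (‖x‖ + R), ?_⟩
  rintro _ ⟨p, rfl⟩
  refine (real_inner_le_norm _ _).trans ?_
  have h1 := hR p p.2
  have h2 : ‖x - p‖ ≤ ‖x‖ + R := (norm_sub_le _ _).trans (by linarith)
  have h3 := hA p
  gcongr

theorem gap_le_add (hA : ∀ x, ‖A x‖ ≤ J) (h𝒳 : IsCompact 𝒳) (hne : 𝒳.Nonempty) (x y : Vec d) :
    gap A 𝒳 x ≤ gap A 𝒳 y + J * ‖x - y‖ := by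
  have : Nonempty 𝒳 := hne.to_subtype
  refine ciSup_le fun p => ?_
  have h1 : inner ℝ (A p) (y - p) ≤ gap A 𝒳 y := le_ciSup (bddAbove_gap hA h𝒳 y) p
  have h2 : inner ℝ (A p) (x - y) ≤ J * ‖x - y‖ :=
    (real_inner_le_norm _ _).trans (by gcongr; exact hA p)
  have e : x - (p : Vec d) = (y - p) + (x - y) := by abel
  rw [e, inner_add_right]
  linarith

theorem abs_gap_sub_le (hA : ∀ x, ‖A x‖ ≤ J) (h𝒳 : IsCompact 𝒳) (hne : 𝒳.Nonempty)
    (x y : Vec d) : |gap A 𝒳 x - gap A 𝒳 y| ≤ J * ‖x - y‖ := by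
  have h1 := gap_le_add hA h𝒳 hne x y
  have h2 := gap_le_add hA h𝒳 hne y x
  rw [norm_sub_rev] at h2
  exact abs_le.2 ⟨by linarith, by linarith⟩

theorem continuous_gap (hA : ∀ x, ‖A x‖ ≤ J) (h𝒳 : IsCompact 𝒳) (hne : 𝒳.Nonempty) :
    Continuous (gap A 𝒳) := by
  have hJ : 0 ≤ J := (norm_nonneg _).trans (hA 0)
  refine LipschitzWith.continuous (K := ⟨J, hJ⟩) (LipschitzWith.of_dist_le_mul fun x y => ?_)
  rw [Real.dist_eq, dist_eq_norm]
  exact abs_gap_sub_le hA h𝒳 hne x y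

/-- The gap of an average is controlled by the regret. -/
theorem gap_average_le (hmon : IsMonotoneOperator A) (hne : 𝒳.Nonempty) {T : ℕ} (hT : 1 ≤ T)
    {x : ℕ → Vec d} {R : ℝ}
    (hR : ∀ p ∈ 𝒳, partialSum (fun t => inner ℝ (A (x t)) (x t - p)) T ≤ R) :
    gap A 𝒳 ((T : ℝ)⁻¹ • ∑ t ∈ Finset.Icc 1 T, x t) ≤ R / T := by
  have : Nonempty 𝒳 := hne.to_subtype
  have hT0 : (0 : ℝ) < T := by exact_mod_cast hT
  refine ciSup_le fun p => ?_
  rw [le_div_iff₀ hT0]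
  refine le_trans ?_ (hR p p.2)
  have e : (T : ℝ)⁻¹ • ∑ t ∈ Finset.Icc 1 T, x t - (p : Vec d) =
      (T : ℝ)⁻¹ • ∑ t ∈ Finset.Icc 1 T, (x t - p) := by
    rw [Finset.sum_sub_distrib, smul_sub]
    congr 1
    rw [Finset.sum_const, Nat.card_Icc, Nat.add_sub_cancel, ← Nat.cast_smul_eq_nsmul ℝ,
      smul_smul, inv_mul_cancel₀ hT0.ne', one_smul]
  rw [e, inner_smul_right, mul_comm, mul_inv_cancel_left₀ hT0.ne', inner_sum]
  refine Finset.sum_le_sum fun t _ => ?_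
  have := hmon (x t) p
  rw [inner_sub_left] at this
  linarith

end Gap

/-! ### The regret of one run -/

/-- The constant of the regret bound. -/
def regretConst (κ L G : ℝ) : ℝ :=
  √(2 + G ^ 2 + 8 * G ^ 2 + 4 * (κ * (1 + G ^ 2))) +
    (1 + L) ^ 2 * (κ * (2 * √(1 + 2 * G ^ 2) * √(1 + G ^ 2)))

theorem regretConst_nonneg {κ L G : ℝ} (hκ : 0 ≤ κ) : 0 ≤ regretConst κ L G := by
  unfold regretConst
  positivity

section Noise

variable {d K : ℕ} (A : Vec d → Vec d) (Xh : ℕ → Vec d) (Vh : ℕ → Fin K → Vec d)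

/-- The value of the operator at the query point of iteration `t ≥ 1`. -/
def operatorValue (t : ℕ) : Vec d := if t = 0 then 0 else A (Xh t)

/-- The error of the averaged feedback of iteration `t ≥ 1`. -/
def feedbackNoise (t : ℕ) : Vec d := nodeAvg (Vh t) - operatorValue A Xh t

/-- The direction that the error of iteration `t` is tested against in the regret analysis. -/
def noiseTerm (qhat : ℝ) (x₁ : Vec d) (t : ℕ) : ℝ :=
  inner ℝ (feedbackNoise A Xh Vh t) (gammaAlt qhat Vh t • nodeAvg (Vh (t - 1))) +
    gammaAlt qhat Vh t * inner ℝ (operatorValue A Xh (t - 1)) (feedbackNoise A Xh Vh (t - 1)) +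
    inner ℝ (feedbackNoise A Xh Vh t) (Xh t - x₁)

end Noise

theorem IsQODARun.gap_le {d K M q : ℕ} {Ξ : Type*} {α : Fin M → ℕ} {typ : Fin d → Fin M}
    {qhat : ℝ} {g : Fin K → Vec d → Ξ → Vec d} {x₁ : Vec d}
    {lev : ℕ → (m : Fin M) → Fin (α m + 2) → ℝ} {ζ : ℕ → Fin K → Ξ × (Fin d → ℝ)}
    {X Xh Y : ℕ → Vec d} {Vh : ℕ → Fin K → Vec d} {A : Vec d → Vec d} {𝒳 : Set (Vec d)}
    {L G D : ℝ} (h : IsQODARun q typ qhat g x₁ lev ζ X Xh Y Vh) (hK : 1 ≤ K)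
    (hqhat : qhat ≤ 1 / 4) (hV : ∀ t k, ‖Vh t k‖ ≤ G) (hL : 0 ≤ L)
    (hmon : IsMonotoneOperator A) (hlip : IsLipschitzOperator L A)
    (hne : 𝒳.Nonempty) (h𝒳 : ∀ p ∈ 𝒳, ‖x₁ - p‖ ≤ D) {T : ℕ} (hT : 1 ≤ T) :
    gap A 𝒳 ((T : ℝ)⁻¹ • ∑ t ∈ Finset.Icc 1 T, Xh t) ≤
      (regretConst K L G * (D ^ 2 + 1) * √T +
        D * ‖∑ t ∈ Finset.Icc 1 T, feedbackNoise A Xh Vh t‖ -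
        partialSum (noiseTerm A Xh Vh qhat x₁) T) / T := by
  refine gap_average_le hmon hne hT fun p hp => ?_
  set f : ℕ → ℝ := fun t => normSqDual (Vh t) with hfdef
  have hf : ∀ t, 0 ≤ f t := fun t => normSqDual_nonneg _
  have hfB : ∀ t, f t ≤ G ^ 2 := fun t => normSqDual_le hK (hV t)
  have hT1 : (1 : ℝ) ≤ T := by exact_mod_cast hT
  have hda := h.isDualAveraging
  have hη := etaAlt_eq X Vh
  have hη0 := stepSize_pos hf hη
  have hreg := hda.optimistic_regret_le hf hfB hη (Nat.cast_nonneg K)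
    (fun t => norm_nodeAvg_sq_le (Vh t))
    (by simp [hfdef, normSqDual, h.init_Vh]) hL (gammaAlt_nonneg qhat Vh)
    (gammaAlt_sq_le hqhat Vh) h.extrapolate (a := operatorValue A Xh)
    (u := feedbackNoise A Xh Vh) (fun t => (add_sub_cancel _ _).symm)
    (fun t ht => by
      rw [operatorValue, operatorValue, if_neg (by omega), if_neg (by omega)]
      exact hlip _ _) hT p
  have hη1 := hda.inv_stepSize_le hf hfB hη (Nat.cast_nonneg K)
    (fun t => norm_nodeAvg_le hK (hV t)) (fun t => norm_nodeAvg_sq_le (Vh t)) hT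
  set c₁ := √(2 + G ^ 2 + 8 * G ^ 2 + 4 * ((K : ℝ) * (1 + G ^ 2))) with hc₁
  have hpD : ‖p - x₁‖ ≤ D := by rw [norm_sub_rev]; exact h𝒳 p hp
  have h1 : ‖p - x₁‖ ^ 2 / (2 * etaAlt X Vh (T + 1)) ≤ c₁ * (D ^ 2 + 1) * √T := by
    have e : ‖p - x₁‖ ^ 2 / (2 * etaAlt X Vh (T + 1)) =
        ‖p - x₁‖ ^ 2 / 2 * (etaAlt X Vh (T + 1))⁻¹ := by
      rw [← div_div, div_eq_mul_inv]
    rw [e]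
    calc ‖p - x₁‖ ^ 2 / 2 * (etaAlt X Vh (T + 1))⁻¹ ≤ (D ^ 2 + 1) * (c₁ * √T) := by
          have h5 : ‖p - x₁‖ ^ 2 ≤ D ^ 2 := by gcongr
          have h6 : ‖p - x₁‖ ^ 2 / 2 ≤ D ^ 2 + 1 := by nlinarith [sq_nonneg D]
          have h7 := (inv_pos.2 (hη0 (T + 1))).le
          gcongr
      _ = _ := by ring
  have h2 : √(1 + partialSum f T) ≤ √(1 + G ^ 2) * √T := by
    rw [← Real.sqrt_mul (by positivity)]
    refine Real.sqrt_le_sqrt ?_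
    have := partialSum_le hfB T
    linarith
  have h3 : (1 + L) ^ 2 * (K * (2 * √(1 + 2 * G ^ 2) * √(1 + partialSum f T))) ≤
      (1 + L) ^ 2 * (K * (2 * √(1 + 2 * G ^ 2) * √(1 + G ^ 2))) * (D ^ 2 + 1) * √T := by
    calc (1 + L) ^ 2 * (K * (2 * √(1 + 2 * G ^ 2) * √(1 + partialSum f T)))
        ≤ (1 + L) ^ 2 * (K * (2 * √(1 + 2 * G ^ 2) * (√(1 + G ^ 2) * √T))) := by gcongr
      _ = (1 + L) ^ 2 * (K * (2 * √(1 + 2 * G ^ 2) * √(1 + G ^ 2))) * 1 * √T := by ring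
      _ ≤ _ := by
        gcongr
        nlinarith [sq_nonneg D]
  -- Recentring at `x₁` confines the dependence of the noise on `p` to one product with the
  -- accumulated error, so the bound is uniform in `p`.
  have hsplit : partialSum (fun t => inner ℝ (A (Xh t)) (Xh t - p)) T =
      partialSum (fun t => inner ℝ (nodeAvg (Vh t)) (Xh t - p)) T -
        partialSum (fun t => inner ℝ (feedbackNoise A Xh Vh t) (Xh t - x₁)) T +
        inner ℝ (∑ t ∈ Finset.Icc 1 T, feedbackNoise A Xh Vh t) (p - x₁) := by
    unfold partialSum
    rw [sum_inner, ← Finset.sum_sub_distrib, ← Finset.sum_add_distrib]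
    refine Finset.sum_congr rfl fun t ht => ?_
    have ht1 := (Finset.mem_Icc.1 ht).1
    have e : A (Xh t) = nodeAvg (Vh t) - feedbackNoise A Xh Vh t := by
      rw [feedbackNoise, operatorValue, if_neg (by omega)]
      abel
    have e2 : Xh t - p = (Xh t - x₁) - (p - x₁) := by abel
    change inner ℝ (A (Xh t)) (Xh t - p) = _
    rw [e, inner_sub_left, sub_add, ← inner_sub_right, ← e2]
  have hnoise : partialSum (noiseTerm A Xh Vh qhat x₁) T =
      partialSum (fun t => inner ℝ (feedbackNoise A Xh Vh t)
        (gammaAlt qhat Vh t • nodeAvg (Vh (t - 1))) + gammaAlt qhat Vh t *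
          inner ℝ (operatorValue A Xh (t - 1)) (feedbackNoise A Xh Vh (t - 1))) T +
        partialSum (fun t => inner ℝ (feedbackNoise A Xh Vh t) (Xh t - x₁)) T :=
    Finset.sum_add_distrib
  have h4 : inner ℝ (∑ t ∈ Finset.Icc 1 T, feedbackNoise A Xh Vh t) (p - x₁) ≤
      D * ‖∑ t ∈ Finset.Icc 1 T, feedbackNoise A Xh Vh t‖ := by
    refine (real_inner_le_norm _ _).trans ?_
    rw [mul_comm]
    gcongr
  have hconst : regretConst K L G * (D ^ 2 + 1) * √T = c₁ * (D ^ 2 + 1) * √T +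
      (1 + L) ^ 2 * (K * (2 * √(1 + 2 * G ^ 2) * √(1 + G ^ 2))) * (D ^ 2 + 1) * √T := by
    rw [regretConst]; ring
  rw [hsplit, hnoise, hconst]
  linarith

end

noncomputable section

/-! ### Random runs -/

/-- A random run of QODA with bounded unbiased oracles; `lev t ω m` is the sequence of levels of
type `m` in force at iteration `t`. -/
structure IsStochasticRun {d K M : ℕ} {Ξ Ω : Type*} [MeasurableSpace Ξ] [mΩ : MeasurableSpace Ω]
    (μ : Measure Ω) (P : Measure Ξ) (ℱ : Filtration ℕ mΩ)
    (ζ : ℕ → Ω → Fin K → Ξ × (Fin d → ℝ)) (A : Vec d → Vec d) (g : Fin K → Vec d → Ξ → Vec d)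
    (J : ℝ) {α : Fin M → ℕ} (q : ℕ) (typ : Fin d → Fin M) (qhat : ℝ) (x₁ : Vec d)
    (lev : ℕ → Ω → (m : Fin M) → Fin (α m + 2) → ℝ)
    (X Xh Y : ℕ → Ω → Vec d) (Vh : ℕ → Ω → Fin K → Vec d) : Prop where
  nodes : 1 ≤ K
  exponent : 1 ≤ q
  qhat_le : qhat ≤ 1 / 4
  continuous : Continuous A
  oracle_measurable : ∀ k, Measurable (Function.uncurry (g k))
  unbiased : ∀ k x, Integrable (g k x) P ∧ ∫ ξ, g k x ξ ∂P = A x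
  bounded : ∀ k, AlmostSurelyBounded P (g k) J
  fresh : IsFreshSampling μ P ℱ ζ
  levels : ∀ t ω m, IsLevelSeq (lev t ω m)
  levels_measurable : ∀ t, Measurable[ℱ t] (lev (t + 1))
  run : ∀ ω, IsQODARun q typ qhat g x₁ (fun t => lev t ω) (fun t => ζ t ω) (fun t => X t ω)
    (fun t => Xh t ω) (fun t => Y t ω) (fun t => Vh t ω)

namespace IsStochasticRun

variable {d K M : ℕ} {Ξ Ω : Type*} [MeasurableSpace Ξ] [mΩ : MeasurableSpace Ω]
  {μ : Measure Ω} {P : Measure Ξ} {ℱ : Filtration ℕ mΩ}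
  {ζ : ℕ → Ω → Fin K → Ξ × (Fin d → ℝ)} {A : Vec d → Vec d} {g : Fin K → Vec d → Ξ → Vec d}
  {J : ℝ} {α : Fin M → ℕ} {q : ℕ} {typ : Fin d → Fin M} {qhat : ℝ} {x₁ : Vec d}
  {lev : ℕ → Ω → (m : Fin M) → Fin (α m + 2) → ℝ}
  {X Xh Y : ℕ → Ω → Vec d} {Vh : ℕ → Ω → Fin K → Vec d}

/-! ### Adaptedness of the iterates -/

theorem measurable_Xh_aux {β : Type*} [MeasurableSpace β] {qhat : ℝ} {t : ℕ}
    {X : β → Vec d} {Vh : ℕ → β → Fin K → Vec d} (hX : Measurable X)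
    (hV : ∀ s ≤ t, Measurable (Vh s)) :
    Measurable fun b => X b - gammaAlt qhat (fun s => Vh s b) (t + 1) • nodeAvg (Vh t b) := by
  have h1 := measurable_gammaAlt qhat (Vh := Vh) (n := t + 1) (fun s hs => hV s (by omega))
    (hV 0 (by omega))
  have h2 := measurable_nodeAvg (hV t le_rfl)
  fun_prop

theorem measurable_update_aux {β : Type*} [MeasurableSpace β] {t : ℕ}
    {X : ℕ → β → Vec d} {Y : β → Vec d} {Vh : ℕ → β → Fin K → Vec d} (hY : Measurable Y)
    (hX : ∀ s ≤ t, Measurable (X (s + 1))) (hV : ∀ s ≤ t, Measurable (Vh s)) (x₁ : Vec d) :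
    Measurable fun b => x₁ + etaAlt (fun s => X s b) (fun s => Vh s b) (t + 2) • Y b := by
  have h1 := measurable_sumSqDual hV
  have h2 := measurable_sumSqMove hX
  unfold etaAlt
  simp only [Nat.add_sub_cancel]
  fun_prop

theorem measurable_query_aux {β : Type*} [MeasurableSpace β] {q : ℕ} {typ : Fin d → Fin M}
    {g : Fin K → Vec d → Ξ → Vec d} (hg : ∀ k, Measurable (Function.uncurry (g k)))
    {l : β → (m : Fin M) → Fin (α m + 2) → ℝ} (hl : Measurable l) {x : β → Vec d}
    (hx : Measurable x) {z : β → Fin K → Ξ × (Fin d → ℝ)} (hz : Measurable z) :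
    Measurable fun b k => quantize q typ (l b) (g k (x b) (z b k).1) (z b k).2 := by
  refine measurable_pi_lambda _ fun k => ?_
  have hzk : Measurable fun b => z b k := (measurable_pi_apply k).comp hz
  exact measurable_quantize q typ hl ((hg k).comp (hx.prodMk hzk.fst)) hzk.snd

variable (h : IsStochasticRun μ P ℱ ζ A g J q typ qhat x₁ lev X Xh Y Vh)
include h

theorem query_eq (t : ℕ) (ω : Ω) : Vh (t + 1) ω = fun k =>
    quantize q typ (lev (t + 1) ω) (g k (Xh (t + 1) ω) (ζ (t + 1) ω k).1) (ζ (t + 1) ω k).2 :=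
  funext fun k => (h.run ω).query (t + 1) (by omega) k

theorem extrapolate_eq (t : ℕ) : Xh (t + 1) = fun ω => X (t + 1) ω -
    gammaAlt qhat (fun s => Vh s ω) (t + 1) • nodeAvg (Vh t ω) :=
  funext fun ω => (h.run ω).extrapolate (t + 1) (by omega)

/-- The learning rates read the whole history, so the induction has to carry all earlier iterates at
once. -/
theorem measurable_iterates (n : ℕ) : ∀ t ≤ n, Measurable[ℱ n] (X (t + 1)) ∧
    Measurable[ℱ n] (Y (t + 1)) ∧ Measurable[ℱ n] (Vh t) := by
  induction n with
  | zero =>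
    intro t ht
    obtain rfl : t = 0 := by omega
    have hX : X 1 = fun _ => x₁ := funext fun ω => (h.run ω).init_X
    have hY : Y 1 = fun _ => 0 := funext fun ω => (h.run ω).init_Y
    have hV : Vh 0 = fun _ _ => 0 := funext fun ω => funext fun k => (h.run ω).init_Vh k
    rw [zero_add, hX, hY, hV]
    exact ⟨measurable_const, measurable_const, measurable_const⟩
  | succ n ih =>
    have hold : ∀ t ≤ n, Measurable[ℱ (n + 1)] (X (t + 1)) ∧
        Measurable[ℱ (n + 1)] (Y (t + 1)) ∧ Measurable[ℱ (n + 1)] (Vh t) := fun t ht =>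
      have hle := ℱ.mono (Nat.le_succ n)
      ⟨(ih t ht).1.mono hle le_rfl, (ih t ht).2.1.mono hle le_rfl, (ih t ht).2.2.mono hle le_rfl⟩
    intro t ht
    rcases Nat.lt_or_ge n t with hlt | hge
    swap
    · exact hold t hge
    obtain rfl : t = n + 1 := by omega
    have hXh : Measurable[ℱ (n + 1)] (Xh (n + 1)) := by
      rw [h.extrapolate_eq]
      exact @measurable_Xh_aux d K Ω (ℱ (n + 1)) _ _ _ _ (hold n le_rfl).1
        fun s hs => (hold s hs).2.2
    have hV : Measurable[ℱ (n + 1)] (Vh (n + 1)) := by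
      rw [funext (h.query_eq n)]
      exact @measurable_query_aux d K M Ξ _ α Ω (ℱ (n + 1)) _ _ _ h.oracle_measurable _
        ((h.levels_measurable n).mono (ℱ.mono (Nat.le_succ n)) le_rfl) _ hXh _
        (h.fresh.adapted n)
    have hY : Measurable[ℱ (n + 1)] (Y (n + 1 + 1)) := by
      rw [show Y (n + 1 + 1) = fun ω => Y (n + 1) ω - nodeAvg (Vh (n + 1) ω) from
        funext fun ω => (h.run ω).dual (n + 1) (by omega)]
      exact (hold n le_rfl).2.1.fun_sub (@measurable_nodeAvg d K Ω (ℱ (n + 1)) _ hV)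
    refine ⟨?_, hY, hV⟩
    rw [show X (n + 1 + 1) = fun ω => x₁ + etaAlt (fun s => X s ω) (fun s => Vh s ω) (n + 2) •
      Y (n + 2) ω from funext fun ω => (h.run ω).update (n + 1) (by omega)]
    exact @measurable_update_aux d K Ω (ℱ (n + 1)) n _ _ _ hY (fun s hs => (hold s hs).1)
      (fun s hs => (hold s hs).2.2) x₁

theorem measurable_Vh {t n : ℕ} (ht : t ≤ n) : Measurable[ℱ n] (Vh t) :=
  (h.measurable_iterates n t ht).2.2

theorem measurable_Xh {t n : ℕ} (ht : t ≤ n) : Measurable[ℱ n] (Xh (t + 1)) := by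
  rw [h.extrapolate_eq]
  exact @measurable_Xh_aux d K Ω (ℱ n) _ _ _ _ (h.measurable_iterates n t ht).1
    fun s hs => h.measurable_Vh (hs.trans ht)

theorem measurable_gamma {t n : ℕ} (ht : t ≤ n + 2) :
    Measurable[ℱ n] fun ω => gammaAlt qhat (fun s => Vh s ω) t :=
  @measurable_gammaAlt d K Ω (ℱ n) qhat Vh t (fun s hs => h.measurable_Vh (by omega))
    (h.measurable_Vh (by omega))

theorem feedbackNoise_zero (ω : Ω) :
    feedbackNoise A (fun s => Xh s ω) (fun s => Vh s ω) 0 = 0 := by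
  have : Vh 0 ω = fun _ => 0 := funext fun k => (h.run ω).init_Vh k
  simp [feedbackNoise, operatorValue, this, nodeAvg]

theorem measurable_feedbackNoise {t n : ℕ} (ht : t ≤ n) :
    Measurable[ℱ n] fun ω => feedbackNoise A (fun s => Xh s ω) (fun s => Vh s ω) t := by
  rcases t with _ | t
  · simp_rw [h.feedbackNoise_zero]
    exact measurable_const
  · have h1 := @measurable_nodeAvg d K Ω (ℱ n) _ (h.measurable_Vh ht)
    have h2 := h.measurable_Xh (show t ≤ n by omega)
    simp only [feedbackNoise, operatorValue]
    simp_rw [if_neg (Nat.succ_ne_zero t)]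
    exact h1.fun_sub (h.continuous.measurable.comp h2)

/-! ### Almost sure bounds and moments of the noise -/

variable [IsProbabilityMeasure P]

theorem nonneg_bound : 0 ≤ J := by
  obtain ⟨ξ, hξ⟩ := (h.bounded ⟨0, h.nodes⟩ 0).exists
  exact (norm_nonneg _).trans hξ

theorem norm_operator_le (x : Vec d) : ‖A x‖ ≤ J := by
  have h1 := h.unbiased ⟨0, h.nodes⟩ x
  rw [← h1.2]
  have := norm_integral_le_of_norm_le_const (h.bounded ⟨0, h.nodes⟩ x)
  simpa using this

variable [IsProbabilityMeasure μ]

/-- The exchanged vectors are almost surely bounded. -/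
theorem ae_norm_Vh_le : ∀ᵐ ω ∂μ, ∀ t k, ‖Vh t ω k‖ ≤ d ^ 2 * J := by
  have hJ := h.nonneg_bound
  rw [ae_all_iff]
  intro t
  rw [ae_all_iff]
  intro k
  rcases t with _ | t
  · refine Filter.Eventually.of_forall fun ω => ?_
    rw [(h.run ω).init_Vh k, norm_zero]
    positivity
  have h1 := h.fresh.ae_of_forall_ae (h.measurable_Xh (le_refl t))
    (p := fun x => ‖g k x.1 (x.2 k).1‖ ≤ J) (by
      have : Measurable fun x : Vec d × (Fin K → Ξ × (Fin d → ℝ)) => g k x.1 (x.2 k).1 :=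
        (h.oracle_measurable k).comp (measurable_fst.prodMk
          ((measurable_pi_apply k).comp measurable_snd).fst)
      exact measurableSet_le this.norm measurable_const)
    (fun x => (h.bounded k).ae_sampleLaw x k)
  filter_upwards [h1] with ω hω
  rw [h.query_eq]
  exact (norm_quantize_le h.exponent (h.levels _ ω) _ _).trans (by gcongr)

/-- The error of an iteration is bounded and orthogonal to everything known before it. -/
theorem integral_inner_feedbackNoise (t : ℕ) {Z : Ω → Vec d} (hZ : Measurable[ℱ t] Z) {b : ℝ}
    (hb : ∀ᵐ ω ∂μ, ‖Z ω‖ ≤ b) :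
    Integrable (fun ω => inner ℝ (feedbackNoise A (fun s => Xh s ω) (fun s => Vh s ω) (t + 1))
      (Z ω)) μ ∧
    ∫ ω, inner ℝ (feedbackNoise A (fun s => Xh s ω) (fun s => Vh s ω) (t + 1)) (Z ω) ∂μ = 0 := by
  have hJ := h.nonneg_bound
  have hXh := h.measurable_Xh (le_refl t)
  let Ψ : Ω → ((m : Fin M) → Fin (α m + 2) → ℝ) × Vec d × Vec d :=
    fun ω => (lev (t + 1) ω, Xh (t + 1) ω, Z ω)
  let f : (((m : Fin M) → Fin (α m + 2) → ℝ) × Vec d × Vec d) ×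
      (Fin K → Ξ × (Fin d → ℝ)) → ℝ := fun x => inner ℝ (nodeAvg (fun k =>
        quantize q typ x.1.1 (g k x.1.2.1 (x.2 k).1) (x.2 k).2) - A x.1.2.1) x.1.2.2
  have hΨ : Measurable[ℱ t] Ψ :=
    (h.levels_measurable t).prodMk (hXh.prodMk hZ)
  have hA := h.continuous.measurable
  have hf : Measurable f := by
    have h1 : Measurable fun x : (((m : Fin M) → Fin (α m + 2) → ℝ) × Vec d × Vec d) ×
        (Fin K → Ξ × (Fin d → ℝ)) => x.1.2.1 := by fun_prop
    have h2 := measurable_nodeAvg (measurable_query_aux (q := q) (typ := typ)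
      h.oracle_measurable (measurable_fst.comp measurable_fst) h1 measurable_snd)
    exact (h2.sub (hA.comp h1)).inner measurable_fst.snd.snd
  have hfeq : ∀ ω, inner ℝ (feedbackNoise A (fun s => Xh s ω) (fun s => Vh s ω) (t + 1)) (Z ω) =
      f (Ψ ω, ζ (t + 1) ω) := by
    intro ω
    simp only [feedbackNoise, operatorValue, h.query_eq, f, Ψ]
    rw [if_neg (by omega)]
  simp_rw [hfeq]
  have hm : Measurable fun ω => f (Ψ ω, ζ (t + 1) ω) :=
    hf.comp ((hΨ.mono (ℱ.le _) le_rfl).prodMk (h.fresh.measurable t))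
  have hint : Integrable (fun ω => f (Ψ ω, ζ (t + 1) ω)) μ := by
    refine Integrable.of_bound hm.aestronglyMeasurable ((d ^ 2 * J + J) * b) ?_
    filter_upwards [hb, h.ae_norm_Vh_le] with ω h1 h2
    rw [← hfeq, feedbackNoise, operatorValue, if_neg (by omega)]
    refine (norm_inner_le_norm _ _).trans ?_
    have h3 := norm_nodeAvg_le h.nodes (h2 (t + 1))
    have h4 := h.norm_operator_le (Xh (t + 1) ω)
    have h5 := (norm_sub_le (nodeAvg (Vh (t + 1) ω)) (A (Xh (t + 1) ω))).trans
      (add_le_add h3 h4)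
    gcongr
  refine ⟨hint, h.fresh.integral_eq_zero hΨ hf hint fun ω => ?_⟩
  exact integral_nodeAvg_quantize h.nodes h.exponent (h.levels _ ω)
    (fun k => (h.oracle_measurable k).comp measurable_prodMk_left) (fun k => h.bounded k _)
    (fun k => h.unbiased k (Xh (t + 1) ω)) _

theorem ae_norm_feedbackNoise_le : ∀ᵐ ω ∂μ, ∀ t,
    ‖feedbackNoise A (fun s => Xh s ω) (fun s => Vh s ω) t‖ ≤ d ^ 2 * J + J := by
  filter_upwards [h.ae_norm_Vh_le] with ω hω t
  have h3 := norm_nodeAvg_le h.nodes (hω t)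
  refine (norm_sub_le _ _).trans (add_le_add h3 ?_)
  rw [operatorValue]
  split_ifs
  · rw [norm_zero]; exact h.nonneg_bound
  · exact h.norm_operator_le _

theorem integral_noiseTerm (t : ℕ) :
    Integrable (fun ω => noiseTerm A (fun s => Xh s ω) (fun s => Vh s ω) qhat x₁ (t + 1)) μ ∧
    ∫ ω, noiseTerm A (fun s => Xh s ω) (fun s => Vh s ω) qhat x₁ (t + 1) ∂μ = 0 := by
  have hγ1 := h.measurable_gamma (show t + 1 ≤ t + 2 by omega)
  have hv := @measurable_nodeAvg d K Ω (ℱ t) _ (h.measurable_Vh (le_refl t))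
  have hγ0 : ∀ ω s, ‖gammaAlt qhat (fun s => Vh s ω) s‖ ≤ 1 := fun ω s => by
    rw [Real.norm_of_nonneg (gammaAlt_nonneg _ _ _)]
    exact gammaAlt_le_one h.qhat_le _ _
  have h1 := h.integral_inner_feedbackNoise t
    (Z := fun ω => gammaAlt qhat (fun s => Vh s ω) (t + 1) • nodeAvg (Vh t ω))
    (hγ1.fun_smul hv) (b := 1 * (d ^ 2 * J)) (by
      filter_upwards [h.ae_norm_Vh_le] with ω hω
      rw [norm_smul]
      exact mul_le_mul (hγ0 _ _) (norm_nodeAvg_le h.nodes (hω t)) (norm_nonneg _) zero_le_one)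
  have h2 := h.integral_inner_feedbackNoise t (Z := fun ω => Xh (t + 1) ω - x₁)
    ((h.measurable_Xh (le_refl t)).sub_const x₁)
    (b := (t + 1) * (d ^ 2 * J)) (by
      filter_upwards [h.ae_norm_Vh_le] with ω hω
      exact (h.run ω).norm_extrapolate_sub_le h.nodes h.qhat_le hω t)
  have h3 : Integrable (fun ω => gammaAlt qhat (fun s => Vh s ω) (t + 1) *
        inner ℝ (operatorValue A (fun s => Xh s ω) t)
          (feedbackNoise A (fun s => Xh s ω) (fun s => Vh s ω) t)) μ ∧
      ∫ ω, gammaAlt qhat (fun s => Vh s ω) (t + 1) *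
        inner ℝ (operatorValue A (fun s => Xh s ω) t)
          (feedbackNoise A (fun s => Xh s ω) (fun s => Vh s ω) t) ∂μ = 0 := by
    rcases t with _ | t
    · simp [h.feedbackNoise_zero]
    -- This term pairs an error with the learning rate of the following iteration. The lag of two in
    -- `gammaAlt` is just enough for that rate to be known before the error is drawn.
    · have hγ2 := h.measurable_gamma (show t + 1 + 1 ≤ t + 2 by omega)
      have := h.integral_inner_feedbackNoise t
        (Z := fun ω => gammaAlt qhat (fun s => Vh s ω) (t + 1 + 1) • A (Xh (t + 1) ω))
        (hγ2.fun_smul (h.continuous.measurable.comp (h.measurable_Xh (le_refl t)))) (b := 1 * J)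
        (Filter.Eventually.of_forall fun ω => by
          rw [norm_smul]
          exact mul_le_mul (hγ0 _ _) (h.norm_operator_le _) (norm_nonneg _) zero_le_one)
      simp_rw [inner_smul_right, real_inner_comm] at this
      simpa [operatorValue] using this
  have hi := h1.1.fun_add h3.1
  have e : ∀ ω, noiseTerm A (fun s => Xh s ω) (fun s => Vh s ω) qhat x₁ (t + 1) =
      inner ℝ (feedbackNoise A (fun s => Xh s ω) (fun s => Vh s ω) (t + 1))
        (gammaAlt qhat (fun s => Vh s ω) (t + 1) • nodeAvg (Vh t ω)) +
      gammaAlt qhat (fun s => Vh s ω) (t + 1) * inner ℝ (operatorValue A (fun s => Xh s ω) t)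
        (feedbackNoise A (fun s => Xh s ω) (fun s => Vh s ω) t) +
      inner ℝ (feedbackNoise A (fun s => Xh s ω) (fun s => Vh s ω) (t + 1))
        (Xh (t + 1) ω - x₁) := fun ω => rfl
  simp_rw [e]
  refine ⟨hi.add h2.1, ?_⟩
  rw [integral_add hi h2.1, integral_add h1.1 h3.1, h1.2, h2.2, h3.2]
  norm_num

theorem integral_partialSum_noiseTerm (n : ℕ) :
    Integrable (fun ω => partialSum
      (noiseTerm A (fun s => Xh s ω) (fun s => Vh s ω) qhat x₁) n) μ ∧
    ∫ ω, partialSum (noiseTerm A (fun s => Xh s ω) (fun s => Vh s ω) qhat x₁) n ∂μ = 0 := by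
  induction n with
  | zero => simp
  | succ n ih =>
    simp_rw [partialSum_succ]
    have h1 := h.integral_noiseTerm n
    refine ⟨ih.1.add h1.1, ?_⟩
    rw [integral_add ih.1 h1.1, ih.2, h1.2, add_zero]

/-- The second moment of the accumulated error grows linearly. -/
theorem integral_norm_sum_feedbackNoise_sq_le (n : ℕ) :
    Integrable (fun ω => ‖∑ t ∈ Finset.Icc 1 n,
      feedbackNoise A (fun s => Xh s ω) (fun s => Vh s ω) t‖ ^ 2) μ ∧
    ∫ ω, ‖∑ t ∈ Finset.Icc 1 n,
      feedbackNoise A (fun s => Xh s ω) (fun s => Vh s ω) t‖ ^ 2 ∂μ ≤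
        n * (d ^ 2 * J + J) ^ 2 := by
  induction n with
  | zero => simp
  | succ n ih =>
    set W : Ω → Vec d := fun ω => ∑ t ∈ Finset.Icc 1 n,
      feedbackNoise A (fun s => Xh s ω) (fun s => Vh s ω) t with hW
    set U : Ω → Vec d := fun ω =>
      feedbackNoise A (fun s => Xh s ω) (fun s => Vh s ω) (n + 1) with hU
    have hWm : Measurable[ℱ n] W := by
      refine Finset.measurable_fun_sum _ fun t ht => ?_
      exact h.measurable_feedbackNoise (Finset.mem_Icc.1 ht).2
    -- The earlier errors are known when the new one is drawn, so the cross term has mean zero and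
    -- only the bounded new square is added.
    have hcross := h.integral_inner_feedbackNoise n hWm (b := n * (d ^ 2 * J + J)) (by
      filter_upwards [h.ae_norm_feedbackNoise_le] with ω hω
      refine (norm_sum_le _ _).trans ((Finset.sum_le_sum fun t _ => hω t).trans ?_)
      rw [Finset.sum_const, Nat.card_Icc, Nat.add_sub_cancel, nsmul_eq_mul])
    have hUm : Measurable U := (h.measurable_feedbackNoise (le_refl (n + 1))).mono (ℱ.le _) le_rfl
    have hUb : ∀ᵐ ω ∂μ, ‖U ω‖ ^ 2 ≤ (d ^ 2 * J + J) ^ 2 := by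
      filter_upwards [h.ae_norm_feedbackNoise_le] with ω hω
      have := hω (n + 1)
      gcongr
    have hUi : Integrable (fun ω => ‖U ω‖ ^ 2) μ := by
      refine Integrable.of_bound (hUm.norm.pow_const 2).aestronglyMeasurable
        ((d ^ 2 * J + J) ^ 2) ?_
      filter_upwards [hUb] with ω hω
      rwa [Real.norm_of_nonneg (by positivity)]
    have hUint : ∫ ω, ‖U ω‖ ^ 2 ∂μ ≤ (d ^ 2 * J + J) ^ 2 := by
      have := integral_mono_ae hUi (integrable_const ((d ^ 2 * J + J) ^ 2)) hUb
      simpa using this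
    have e : ∀ ω, ‖∑ t ∈ Finset.Icc 1 (n + 1),
        feedbackNoise A (fun s => Xh s ω) (fun s => Vh s ω) t‖ ^ 2 =
        ‖W ω‖ ^ 2 + 2 * inner ℝ (U ω) (W ω) + ‖U ω‖ ^ 2 := fun ω => by
      rw [Finset.sum_Icc_succ_top (by omega), norm_add_sq_real, real_inner_comm]
    simp_rw [e]
    have h1 : Integrable (fun ω => ‖W ω‖ ^ 2 + 2 * inner ℝ (U ω) (W ω)) μ :=
      ih.1.add (hcross.1.const_mul 2)
    refine ⟨h1.add hUi, ?_⟩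
    rw [integral_add h1 hUi, integral_add ih.1 (hcross.1.const_mul 2), integral_const_mul,
      hcross.2]
    push_cast
    linarith [ih.2]

/-- The expected gap of the averaged iterate. -/
theorem integral_gap_le {𝒳 : Set (Vec d)} {L D : ℝ} (hL : 0 ≤ L) (hmon : IsMonotoneOperator A)
    (hlip : IsLipschitzOperator L A) (hcpt : IsCompact 𝒳) (hne : 𝒳.Nonempty)
    (h𝒳 : ∀ p ∈ 𝒳, ‖x₁ - p‖ ≤ D) {T : ℕ} (hT : 1 ≤ T) :
    Integrable (fun ω => gap A 𝒳 ((T : ℝ)⁻¹ • ∑ t ∈ Finset.Icc 1 T, Xh t ω)) μ ∧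
    ∫ ω, gap A 𝒳 ((T : ℝ)⁻¹ • ∑ t ∈ Finset.Icc 1 T, Xh t ω) ∂μ ≤
      (regretConst K L (d ^ 2 * J) + ((d ^ 2 * J + J) ^ 2 + 1)) * (D ^ 2 + 1) / √T := by
  have hT0 : (0 : ℝ) < T := by exact_mod_cast hT
  have hsT : 0 < √(T : ℝ) := Real.sqrt_pos.2 hT0
  set G : ℝ := d ^ 2 * J with hG
  have hJ := h.nonneg_bound
  set W : Ω → ℝ := fun ω => ‖∑ t ∈ Finset.Icc 1 T,
    feedbackNoise A (fun s => Xh s ω) (fun s => Vh s ω) t‖ with hW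
  set N : Ω → ℝ := fun ω => partialSum
    (noiseTerm A (fun s => Xh s ω) (fun s => Vh s ω) qhat x₁) T with hN
  have hW2 := h.integral_norm_sum_feedbackNoise_sq_le T
  have hN2 := h.integral_partialSum_noiseTerm T
  have hint : Integrable (fun ω => gap A 𝒳 ((T : ℝ)⁻¹ • ∑ t ∈ Finset.Icc 1 T, Xh t ω)) μ := by
    have hm : Measurable fun ω => (T : ℝ)⁻¹ • ∑ t ∈ Finset.Icc 1 T, Xh t ω := by
      refine Measurable.fun_const_smul (Finset.measurable_fun_sum _ fun t ht => ?_) (T : ℝ)⁻¹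
      obtain ⟨r, rfl⟩ : ∃ r, t = r + 1 := ⟨t - 1, by have := (Finset.mem_Icc.1 ht).1; omega⟩
      exact (h.measurable_Xh (le_refl r)).mono (ℱ.le _) le_rfl
    refine Integrable.of_bound ((continuous_gap h.norm_operator_le hcpt hne).measurable.comp
      hm).aestronglyMeasurable (|gap A 𝒳 x₁| + J * (T * G)) ?_
    filter_upwards [h.ae_norm_Vh_le] with ω hω
    have h1 := abs_gap_sub_le h.norm_operator_le hcpt hne
      ((T : ℝ)⁻¹ • ∑ t ∈ Finset.Icc 1 T, Xh t ω) x₁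
    have h2 : ‖(T : ℝ)⁻¹ • ∑ t ∈ Finset.Icc 1 T, Xh t ω - x₁‖ ≤ T * G := by
      have e : (T : ℝ)⁻¹ • ∑ t ∈ Finset.Icc 1 T, Xh t ω - x₁ =
          (T : ℝ)⁻¹ • ∑ t ∈ Finset.Icc 1 T, (Xh t ω - x₁) := by
        rw [Finset.sum_sub_distrib, smul_sub]
        congr 1
        rw [Finset.sum_const, Nat.card_Icc, Nat.add_sub_cancel, ← Nat.cast_smul_eq_nsmul ℝ,
          smul_smul, inv_mul_cancel₀ hT0.ne', one_smul]
      rw [e, norm_smul, norm_inv, Real.norm_natCast, inv_mul_le_iff₀ hT0]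
      refine (norm_sum_le _ _).trans ?_
      calc ∑ t ∈ Finset.Icc 1 T, ‖Xh t ω - x₁‖ ≤ ∑ t ∈ Finset.Icc 1 T, T * G := by
            refine Finset.sum_le_sum fun t ht => ?_
            obtain ⟨h3, h4⟩ := Finset.mem_Icc.1 ht
            obtain ⟨r, rfl⟩ : ∃ r, t = r + 1 := ⟨t - 1, by omega⟩
            refine ((h.run ω).norm_extrapolate_sub_le h.nodes h.qhat_le hω r).trans ?_
            have h5 : ((r : ℝ) + 1) ≤ T := by exact_mod_cast h4
            gcongr
        _ = T * (T * G) := by simp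
    have h3 : J * ‖(T : ℝ)⁻¹ • ∑ t ∈ Finset.Icc 1 T, Xh t ω - x₁‖ ≤ J * (T * G) := by gcongr
    have h4 := abs_sub_abs_le_abs_sub (gap A 𝒳 ((T : ℝ)⁻¹ • ∑ t ∈ Finset.Icc 1 T, Xh t ω))
      (gap A 𝒳 x₁)
    rw [Real.norm_eq_abs]
    change |gap A 𝒳 ((T : ℝ)⁻¹ • ∑ t ∈ Finset.Icc 1 T, Xh t ω)| ≤ _
    linarith
  refine ⟨hint, ?_⟩
  set c := regretConst K L G with hc
  have hbound : ∀ᵐ ω ∂μ, gap A 𝒳 ((T : ℝ)⁻¹ • ∑ t ∈ Finset.Icc 1 T, Xh t ω) ≤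
      (c * (D ^ 2 + 1) * √T + (D ^ 2 + 1) * √T + (D ^ 2 + 1) / √T * W ω ^ 2 - N ω) / T := by
    filter_upwards [h.ae_norm_Vh_le] with ω hω
    refine ((h.run ω).gap_le h.nodes h.qhat_le hω hL hmon hlip hne h𝒳 hT).trans ?_
    change (c * (D ^ 2 + 1) * √T + D * W ω - N ω) / T ≤ _
    -- Trading `W` for its square reduces everything to the second moment; the weight `√T` balances
    -- the two terms, as that moment is of order `T`.
    have h1 : D * W ω ≤ (D ^ 2 + 1) * √T + (D ^ 2 + 1) / √T * W ω ^ 2 := by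
      have hW0 : 0 ≤ W ω := norm_nonneg _
      have h2 : W ω ≤ √T + W ω ^ 2 / √T := by
        rw [← sub_le_iff_le_add', le_div_iff₀ hsT]
        nlinarith [sq_nonneg (W ω - √T)]
      have h3 : D ≤ D ^ 2 + 1 := by nlinarith [sq_nonneg (D - 1)]
      calc D * W ω ≤ (D ^ 2 + 1) * (√T + W ω ^ 2 / √T) := by gcongr
        _ = _ := by ring
    refine div_le_div_of_nonneg_right ?_ hT0.le
    linarith
  have hi1 : Integrable (fun ω => (D ^ 2 + 1) / √(T : ℝ) * W ω ^ 2) μ := hW2.1.const_mul _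
  have hi2 : Integrable (fun ω => c * (D ^ 2 + 1) * √(T : ℝ) + (D ^ 2 + 1) * √T +
      (D ^ 2 + 1) / √T * W ω ^ 2) μ := (integrable_const _).add hi1
  have hN1 : Integrable N μ := hN2.1
  refine (integral_mono_ae hint ((hi2.sub hN1).div_const _) hbound).trans ?_
  rw [integral_div, integral_sub' hi2 hN1, integral_add (integrable_const _) hi1,
    integral_const_mul, hN2.2]
  have h4 : (D ^ 2 + 1) / √(T : ℝ) * ∫ ω, W ω ^ 2 ∂μ ≤
      (D ^ 2 + 1) / √(T : ℝ) * (T * (G + J) ^ 2) := by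
    have := hW2.2
    gcongr
  have h5 : (D ^ 2 + 1) / √(T : ℝ) * (T * (G + J) ^ 2) = (D ^ 2 + 1) * √T * (G + J) ^ 2 := by
    have h6 : (T : ℝ) = √T * √T := (Real.mul_self_sqrt hT0.le).symm
    calc (D ^ 2 + 1) / √(T : ℝ) * (T * (G + J) ^ 2) =
        (D ^ 2 + 1) * (T / √(T : ℝ)) * (G + J) ^ 2 := by ring
      _ = _ := by rw [Real.div_sqrt]
  rw [div_le_div_iff₀ hT0 hsT]
  simp only [integral_const, probReal_univ, smul_eq_mul, one_mul]
  have h7 : c * (D ^ 2 + 1) * √(T : ℝ) + (D ^ 2 + 1) * √T +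
      (D ^ 2 + 1) / √(T : ℝ) * ∫ ω, W ω ^ 2 ∂μ - 0 ≤
      (c + ((G + J) ^ 2 + 1)) * (D ^ 2 + 1) * √T := by
    rw [h5] at h4
    linarith
  calc (c * (D ^ 2 + 1) * √(T : ℝ) + (D ^ 2 + 1) * √T +
      (D ^ 2 + 1) / √(T : ℝ) * ∫ ω, W ω ^ 2 ∂μ - 0) * √T ≤
      (c + ((G + J) ^ 2 + 1)) * (D ^ 2 + 1) * √T * √T := by gcongr
    _ = (c + ((G + J) ^ 2 + 1)) * (D ^ 2 + 1) * T := by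
      rw [mul_assoc _ √(T : ℝ), Real.mul_self_sqrt hT0.le]

end IsStochasticRun

end

/-! ### The main theorem -/

theorem mainTheorem6 (d K N : ℕ) (hK : 1 ≤ K) (L J D₀ : ℝ) (hL : 0 < L) (hJ : 0 < J)
    (hD₀ : 0 < D₀) :
    ∃ C : ℝ,
      -- the variational inequality, the test domain and the starting point
      ∀ (A : Vec d → Vec d) (xstar x₁ : Vec d) (𝒳 : Set (Vec d)) (D : ℝ),
      IsMonotoneOperator A → IsLipschitzOperator L A → IsVISolution A xstar →
      IsCompact 𝒳 → 𝒳 ∈ 𝓝 xstar →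
      D₀ ≤ D → IsLUB ((fun p => ‖x₁ - p‖ ^ 2) '' 𝒳) (D ^ 2) →
      -- the stochastic oracles of the nodes
      ∀ (Ξ : Type u) [MeasurableSpace Ξ] (P : Measure Ξ) [IsProbabilityMeasure P]
        (g : Fin K → Vec d → Ξ → Vec d) (σ : ℝ), 0 ≤ σ →
      (∀ k, Measurable (Function.uncurry (g k))) →
      (∀ k, AbsoluteNoise P A (g k) σ) → (∀ k, AlmostSurelyBounded P (g k) J) →
      -- the randomness of the algorithm
      ∀ (Ω : Type v) [mΩ : MeasurableSpace Ω] (μ : Measure Ω) [IsProbabilityMeasure μ]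
        (ℱ : Filtration ℕ mΩ) (ζ : ℕ → Ω → Fin K → Ξ × (Fin d → ℝ)),
      IsFreshSampling μ P ℱ ζ →
      -- the quantizer: `lev m j` is the `j`-th sequence of levels of type `m`, and `ep m t` is the
      -- index of the sequence of type `m` that is in force at iteration `t`
      ∀ (q M : ℕ) (typ : Fin d → Fin M) (α : Fin M → ℕ) (Jm : Fin M → ℕ)
        (lev : (m : Fin M) → Fin (Jm m) → Ω → Fin (α m + 2) → ℝ)
        (ep : (m : Fin M) → ℕ → Fin (Jm m)),
      1 ≤ q → (∀ m, α m ≤ N) → (∀ m j ω, IsLevelSeq (lev m j ω)) →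
      (∀ m t, Measurable[ℱ t] (lev m (ep m (t + 1)))) →
      -- the iterates of the algorithm
      ∀ (qhat : ℝ) (X Xh Y : ℕ → Ω → Vec d) (Vh : ℕ → Ω → Fin K → Vec d),
      0 < qhat → qhat ≤ 1 / 4 →
      (∀ ω, IsQODARun q typ qhat g x₁ (fun t m => lev m (ep m t) ω) (fun t => ζ t ω)
        (fun t => X t ω) (fun t => Xh t ω) (fun t => Y t ω) (fun t => Vh t ω)) →
      -- the horizon, the variance bounds, and the numbers of iterations that they are used for
      ∀ (T : ℕ) (Tmj ε : (m : Fin M) → Fin (Jm m) → ℝ), 1 ≤ T →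
      (∀ m j, ∀ᵐ ω ∂μ, varianceBound d q (lev m j ω) ≤ ε m j) →
      (∀ m j, 0 ≤ Tmj m j ∧
        Tmj m j ≤ (((Finset.Icc 1 T).filter fun t => ep m t = j).card : ℝ)) →
      ∑ m, ∑ j, Tmj m j = (T : ℝ) →
      Integrable (fun ω => gap A 𝒳 ((T : ℝ)⁻¹ • ∑ t ∈ Finset.Icc 1 T, Xh t ω)) μ ∧
        ∫ ω, gap A 𝒳 ((T : ℝ)⁻¹ • ∑ t ∈ Finset.Icc 1 T, Xh t ω) ∂μ ≤
          C * (((L * D + ‖A x₁‖ + σ) * avgSqrtVariance T Tmj ε + σ) * D ^ 4 / √(T : ℝ)) := by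
  set c₀ : ℝ := √((1 / 4 : ℝ) ^ N / 8) with hc₀
  set c₁ : ℝ := regretConst K L (d ^ 2 * J) + ((d ^ 2 * J + J) ^ 2 + 1) with hc₁
  have hc₀pos : 0 < c₀ := Real.sqrt_pos.2 (by positivity)
  have hc₁pos : 0 ≤ c₁ := by
    have := regretConst_nonneg (κ := K) (L := L) (G := d ^ 2 * J) (Nat.cast_nonneg K)
    positivity
  -- The bracket with `D₀` converts `D ^ 2 + 1` into `D ^ 5`, and division by `L * c₀` compensates
  -- the lower bound `L * D * c₀` for the noise factor.
  refine ⟨c₁ * (1 / D₀ ^ 3 + 1 / D₀ ^ 5) / (L * c₀), ?_⟩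
  intro A xstar x₁ 𝒳 D hmon hlip _ hcpt hnhds hD hlub Ξ _ P _ g σ hσ hg hnoise hbdd Ω mΩ μ _ ℱ ζ
    hζ q M typ α Jm lev ep hq hα hlev hlevm qhat X Xh Y Vh _ hqhat hrun T Tmj ε hT hε hTmj hsum
  have hD0 : 0 < D := hD₀.trans_le hD
  have hne : 𝒳.Nonempty := ⟨xstar, mem_of_mem_nhds hnhds⟩
  have h𝒳 : ∀ p ∈ 𝒳, ‖x₁ - p‖ ≤ D := fun p hp =>
    (pow_le_pow_iff_left₀ (norm_nonneg _) hD0.le two_ne_zero).1 (hlub.1 ⟨p, hp, rfl⟩)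
  -- In dimension 0 all distances vanish, which contradicts `D > 0`.
  have hd : 1 ≤ d := by
    by_contra! hd
    obtain rfl : d = 0 := by omega
    have : D ^ 2 ≤ 0 := hlub.2 (by
      rintro _ ⟨p, _, rfl⟩
      simp [Subsingleton.elim x₁ p])
    nlinarith
  have hcont : Continuous A := by
    refine LipschitzWith.continuous (K := ⟨L, hL.le⟩) (LipschitzWith.of_dist_le_mul fun x y => ?_)
    rw [dist_eq_norm, dist_eq_norm]
    exact hlip x y
  have hS : IsStochasticRun μ P ℱ ζ A g J q typ qhat x₁ (fun t ω m => lev m (ep m t) ω)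
      X Xh Y Vh :=
    { nodes := hK
      exponent := hq
      qhat_le := hqhat
      continuous := hcont
      oracle_measurable := hg
      unbiased := fun k x => ⟨(hnoise k x).1, (hnoise k x).2.1⟩
      bounded := hbdd
      fresh := hζ
      levels := fun t ω m => hlev m _ ω
      levels_measurable := fun t => (@measurable_pi_iff _ _ _ (ℱ t) _ _).2 fun m => hlevm m t
      run := hrun }
  obtain ⟨hint, hgap⟩ := hS.integral_gap_le hL.le hmon hlip hcpt hne h𝒳 hT
  refine ⟨hint, hgap.trans ?_⟩
  have havg : c₀ ≤ avgSqrtVariance T Tmj ε := by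
    refine le_avgSqrtVariance hT (fun m j => ?_) (fun m j => (hTmj m j).1) hsum
    -- The lower bound holds for every level sequence, so one outcome satisfying the almost sure
    -- bound transfers it to the number `ε m j`.
    obtain ⟨ω, hω⟩ := (hε m j).exists
    exact ((hlev m j ω).le_varianceBound hd hq (hα m)).trans hω
  have hsT : 0 < √(T : ℝ) := Real.sqrt_pos.2 (by exact_mod_cast hT)
  have hD2 : D ^ 2 + 1 ≤ (1 / D₀ ^ 3 + 1 / D₀ ^ 5) * D ^ 5 := by
    have h1 : D ^ 2 ≤ 1 / D₀ ^ 3 * D ^ 5 := by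
      rw [one_div_mul_eq_div, le_div_iff₀ (by positivity)]
      calc D ^ 2 * D₀ ^ 3 ≤ D ^ 2 * D ^ 3 := by gcongr
        _ = D ^ 5 := by ring
    have h2 : 1 ≤ 1 / D₀ ^ 5 * D ^ 5 := by
      rw [one_div_mul_eq_div, le_div_iff₀ (by positivity), one_mul]
      gcongr
    linarith
  have hvar : L * D * c₀ ≤ (L * D + ‖A x₁‖ + σ) * avgSqrtVariance T Tmj ε + σ := by
    have h1 : L * D * c₀ ≤ (L * D + ‖A x₁‖ + σ) * avgSqrtVariance T Tmj ε := by
      have := norm_nonneg (A x₁)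
      gcongr
      linarith
    linarith
  calc c₁ * (D ^ 2 + 1) / √(T : ℝ)
      ≤ c₁ * ((1 / D₀ ^ 3 + 1 / D₀ ^ 5) * D ^ 5) / √(T : ℝ) := by gcongr
    _ = c₁ * (1 / D₀ ^ 3 + 1 / D₀ ^ 5) / (L * c₀) * (L * D * c₀ * D ^ 4 / √(T : ℝ)) := by
        field_simp
    _ ≤ _ := by gcongr
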